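/- **Setting.** For $k\ge 2$, an instance of $k$-MPMD (min-cost perfect $k$-way matching with delays) with $m$ requests ($k\mid m$) gives each request $v$ an arrival time $\mathrm{atime}(v)\ge 0$ and a position $\mathrm{pos}(v)$. The requests have to be partitioned into groups of size $k$; matching a group $\{v_1,\dots,v_k\}$ at a time $\tau\ge\max_i\mathrm{atime}(v_i)$ costs $d(\mathrm{pos}(v_1),\dots,\mathrm{pos}(v_k))+\sum_i(\tau-\mathrm{atime}(v_i))$. $\mathrm{OPT}(\sigma)$ is the optimal offline total cost. Here positions are in $\mathbb R$ and $d=d_{\mathrm D}$, $d_{\mathrm D}(p_1,\dots,p_k)=\max_{i,j}|p_i-p_j|$. **The algorithm GD-$k$.** Fix a distance $\rho$ on $\mathbb R$ and put $\mathrm{opt\text{-}cost}(u,v)=\rho(\mathrm{pos}(u),\mathrm{pos}(v))+|\mathrm{atime}(u)-\mathrm{atime}(v)|$ and $r=1/k^2$. Every arrived request $v$ belongs to exactly one active set $A(v)$, initially $\{v\}$, and every set $S$ of requests has a variable $y_S$, initially $0$. While time passes, $y_S$ grows at rate $r$ for each active set $S$ containing an unmatched request. A pair $(u,v)$ of arrived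 requests is tight if $\sum_{S:\,|S\cap\{u,v\}|=1}y_S=r\cdot\mathrm{opt\text{-}cost}(u,v)$. As soon as a pair with $A(u)\ne A(v)$ is tight, these two sets are replaced by the active set $A(u)\cup A(v)$, and groups of $k$ unmatched requests of it, arbitrarily chosen, are matched until fewer than $k$ of its requests are unmatched. Write $\mathrm{GD}_\rho(\sigma)$ for the cost of an output of this algorithm on $\sigma$, for any way of making the arbitrary choices; its competitive ratio on instances with $m$ requests is $\sup_\sigma \mathrm{GD}_\rho(\sigma)/\mathrm{OPT}(\sigma)$, taken over all instances $\sigma$ with $m$ requests and all outputs. **The instance.** Let $k\ge2$, $s\ge1$, $m=sk^2$, $\varepsilon>0$, $w>0$. In $\sigma_l(w,\varepsilon)$ one request arrives at each of the points $0,w,2w,\dots,(k-1)w$ at each of the times $t_1=0$ and $t_i=1+(2i-3)\varepsilon$, $2\le i\le sk$. **Theorem.** Let $k\ge2$, $s\ge1$ and $m=sk^2$. (a) Let $\rho(p,q)=|p-q|$ and $\sigma_l=\sigma_l(2,\varepsilon)$. For every $\varepsilon>0$, $$0<\mathrm{OPT}(\sigma_l)\le k(1+\varepsilon+k^2\varepsilon+m\varepsilon),$$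 If $\varepsilon\le 1$, then GD-$k$ has an output on $\sigma_l$, and every output satisfies $$\mathrm{GD}_\rho(\sigma_l)\ge m+k+(m-k)\varepsilon.$$ If $\varepsilon\le 1/\max\{k^2,m\}$, every output satisfies $\mathrm{GD}_\rho(\sigma_l)/\mathrm{OPT}(\sigma_l)\ge\frac{m+k}{4k}$. Hence the competitive ratio of GD-$k$ on instances with $m$ requests is at least $\frac{m+k}{4k}=\Omega(m/k)$. (b) The same holds with $\rho(p,q)=d_{\mathrm D}(p,q,\dots,q)+d_{\mathrm D}(q,p,\dots,p)=2|p-q|$ and $\sigma_l=\sigma_l(1,\varepsilon)$, if the lower bound $m+k+(m-k)\varepsilon$ is replaced by $\frac m2+k+(m-k)\varepsilon$ and $\frac{m+k}{4k}$ by $\frac{m/2+k}{4k}$, which is again $\Omega(m/k)$. -/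

import Mathlib

open scoped ENNReal

/-- An instance of `k`-MPMD with `m` requests `u_0, …, u_{m-1}` in a set `χ`: the requests are
indexed in their order of arrival, and `m` is a multiple of `k`. -/
structure MPMDInstance (χ : Type*) (k m : ℕ) where
  /-- arrival times -/
  atime : Fin m → ℝ
  /-- locations -/
  pos : Fin m → χ
  atime_nonneg : ∀ v, 0 ≤ atime v
  atime_mono : Monotone atime
  dvd : k ∣ m

/-- A family of groups of requests, with the time at which each group is matched
(`mtime F` is only meaningful for `F ∈ groups`). -/
structure Schedule (m : ℕ) where
  groups : Finset (Finset (Fin m))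
  mtime : Finset (Fin m) → ℝ

section Problem

variable {χ : Type*} {k m : ℕ}

/-- The value of the `k`-point function `d` at the positions of the `k` members of a group `F`,
listed in the order of their indices (the order is irrelevant when `d` is symmetric). -/
noncomputable def groupDist (d : (Fin k → χ) → ℝ) (pos : Fin m → χ) (F : Finset (Fin m)) : ℝ :=
  if h : F.card = k then d (fun i => pos (F.orderEmbOfFin h i)) else 0

/-- The groups form a perfect `k`-way matching, and no group is matched before all of its members
have arrived. -/
def Schedule.IsFeasible (σ : MPMDInstance χ k m) (R : Schedule m) : Prop :=
  (∀ F ∈ R.groups, F.card = k) ∧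
  (∀ F ∈ R.groups, ∀ G ∈ R.groups, F ≠ G → Disjoint F G) ∧
  (∀ v, ∃ F ∈ R.groups, v ∈ F) ∧
  (∀ F ∈ R.groups, ∀ v ∈ F, σ.atime v ≤ R.mtime F)

/-- Total cost: for each group, the distance cost plus the waiting cost of its members. -/
noncomputable def Schedule.cost (d : (Fin k → χ) → ℝ) (σ : MPMDInstance χ k m)
    (R : Schedule m) : ℝ :=
  ∑ F ∈ R.groups, (groupDist d σ.pos F + ∑ v ∈ F, (R.mtime F - σ.atime v))

/-- The offline optimum. -/
noncomputable def OPT (d : (Fin k → χ) → ℝ) (σ : MPMDInstance χ k m) : ℝ :=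
  sInf {c : ℝ | ∃ R : Schedule m, R.IsFeasible σ ∧ R.cost d σ = c}

/-- The distance of two points that a `k`-point metric `d` induces:
`d(p, q, …, q) + d(q, p, …, p)`. -/
noncomputable def inducedDist (d : (Fin k → χ) → ℝ) (p q : χ) : ℝ :=
  d (fun i => if i.val = 0 then p else q) + d (fun i => if i.val = 0 then q else p)

end Problem

section GreedyDual

variable {χ : Type*} {k m : ℕ}

/-- The state of GD-`k`: the current time, the requests that have arrived, the active set `A(v)`
of every arrived request `v`, the dual variables `y_S`, and the `k`-way matching made so far
together with the times at which its groups were matched. -/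
structure GDState (m : ℕ) where
  time : ℝ
  arrived : Finset (Fin m)
  A : Fin m → Finset (Fin m)
  y : Finset (Fin m) → ℝ
  sched : Schedule m

/-- The state at time `0`, before any arrival. -/
def GDState.init (m : ℕ) : GDState m where
  time := 0
  arrived := ∅
  A := fun _ => ∅
  y := fun _ => 0
  sched := ⟨∅, fun _ => 0⟩

/-- The free (not yet matched) requests of `S`. -/
def GDState.free (X : GDState m) (S : Finset (Fin m)) : Finset (Fin m) :=
  S.filter (fun v => ∀ F ∈ X.sched.groups, v ∉ F)

/-- `S` is active. -/
def GDState.IsActive (X : GDState m) (S : Finset (Fin m)) : Prop :=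
  ∃ v ∈ X.arrived, X.A v = S

open Classical in
/-- `Δ` units of time pass: `y_S` grows at rate `r = 1 / (γ k²)` for every active set `S` that
contains a free request. -/
noncomputable def GDState.advance (k : ℕ) (γ : ℝ) (X : GDState m) (Δ : ℝ) : GDState m :=
  { X with
    time := X.time + Δ
    y := fun S =>
      if X.IsActive S ∧ (X.free S).Nonempty then X.y S + 1 / (γ * (k : ℝ) ^ 2) * Δ else X.y S }

/-- Request `v` arrives. -/
def GDState.arrive (X : GDState m) (v : Fin m) : GDState m :=
  { X with
    arrived := insert v X.arrived
    A := Function.update X.A v {v}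
    y := fun S => if v ∈ S then 0 else X.y S }

/-- The active sets of `u` and `v` are merged, and the groups in `P` are matched now. -/
def GDState.merge (X : GDState m) (u v : Fin m) (P : Finset (Finset (Fin m))) : GDState m :=
  { X with
    A := fun w => if w ∈ X.A u ∪ X.A v then X.A u ∪ X.A v else X.A w
    sched :=
      { groups := X.sched.groups ∪ P
        mtime := fun F => if F ∈ P then X.time else X.sched.mtime F } }

/-- The cost of a pair of requests, for the distance `ρ` between two points. -/
noncomputable def pairOptCost (ρ : χ → χ → ℝ) (σ : MPMDInstance χ k m) (u v : Fin m) : ℝ :=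
  ρ (σ.pos u) (σ.pos v) + |σ.atime u - σ.atime v|

/-- The pair `(u, v)` is tight: the sum of `y_S` over the sets `S` that contain exactly one of
`u`, `v` is `1 / (γ k²)` times the cost of the pair. -/
def GDState.IsTight (ρ : χ → χ → ℝ) (γ : ℝ) (σ : MPMDInstance χ k m) (X : GDState m)
    (u v : Fin m) : Prop :=
  ∑ S ∈ Finset.univ.filter (fun S : Finset (Fin m) => ¬ (u ∈ S ↔ v ∈ S)), X.y S =
    1 / (γ * (k : ℝ) ^ 2) * pairOptCost ρ σ u v

/-- Some tight pair of arrived requests lies in two different active sets. -/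
def GDState.HasMergeablePair (ρ : χ → χ → ℝ) (γ : ℝ) (σ : MPMDInstance χ k m)
    (X : GDState m) : Prop :=
  ∃ u ∈ X.arrived, ∃ v ∈ X.arrived, X.A u ≠ X.A v ∧ X.IsTight ρ γ σ u v

/-- One step of GD-`k`, run with the distance `ρ` between two points and the parameter `γ`. At any
moment arrivals are handled first (in the order of the requests), then tight pairs (in any order),
and time passes only when there is nothing left to do. -/
inductive GDStep (ρ : χ → χ → ℝ) (γ : ℝ) (σ : MPMDInstance χ k m) :
    GDState m → GDState m → Prop
  | arrive (X : GDState m) (v : Fin m) (hnew : v ∉ X.arrived) (htime : σ.atime v = X.time)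
      (horder : ∀ w, w < v → w ∈ X.arrived) :
      GDStep ρ γ σ X (X.arrive v)
  | merge (X : GDState m) (u v : Fin m) (P : Finset (Finset (Fin m)))
      (harr : ∀ w, w ∉ X.arrived → X.time < σ.atime w)
      (hu : u ∈ X.arrived) (hv : v ∈ X.arrived) (hne : X.A u ≠ X.A v)
      (htight : X.IsTight ρ γ σ u v)
      (hP : ∀ F ∈ P, F ⊆ X.free (X.A u ∪ X.A v) ∧ F.card = k)
      (hdisj : ∀ F ∈ P, ∀ G ∈ P, F ≠ G → Disjoint F G)
      (hrest : (X.free (X.A u ∪ X.A v) \ P.biUnion id).card < k) :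
      GDStep ρ γ σ X (X.merge u v P)
  | elapse (X : GDState m) (Δ : ℝ) (hΔ : 0 < Δ)
      (harr : ∀ w, w ∉ X.arrived → X.time + Δ ≤ σ.atime w)
      (hquiet : ∀ δ, 0 ≤ δ → δ < Δ → ¬ (X.advance k γ δ).HasMergeablePair ρ γ σ) :
      GDStep ρ γ σ X (X.advance k γ Δ)

/-- `R` is a possible output of GD-`k` on `σ`: the matching held in a reachable state in which
every request has been matched. (GD-`k` makes arbitrary choices, hence a relation.) -/
def IsGDOutput (ρ : χ → χ → ℝ) (γ : ℝ) (σ : MPMDInstance χ k m) (R : Schedule m) : Prop :=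
  ∃ X : GDState m, Relation.ReflTransGen (GDStep ρ γ σ) (GDState.init m) X ∧
    (∀ v, ∃ F ∈ X.sched.groups, v ∈ F) ∧ X.sched = R

/-- The competitive ratio of GD-`k` on the instances with `m` requests: the supremum of the ratio
of the cost of an output to the optimum. -/
noncomputable def gdCompetitiveRatio (d : (Fin k → χ) → ℝ) (ρ : χ → χ → ℝ) (γ : ℝ)
    (m : ℕ) : ℝ≥0∞ :=
  ⨆ (σ : MPMDInstance χ k m) (R : Schedule m) (_ : IsGDOutput ρ γ σ R),
    ENNReal.ofReal (R.cost d σ) / ENNReal.ofReal (OPT d σ)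

end GreedyDual

section Line

/-- The diameter on a line, `max_{i,j} |p_i - p_j|`. -/
noncomputable def lineDiam (k : ℕ) (p : Fin k → ℝ) : ℝ :=
  ⨆ ij : Fin k × Fin k, |p ij.1 - p ij.2|

/-- The distance of two points of the line. -/
def lineDist (p q : ℝ) : ℝ := |p - q|

/-- Arrival time of the wave number `q` (counted from `0`): `0` for the first wave, and
`1 + (2 q - 1) ε` for the later ones. -/
noncomputable def waveTime (ε : ℝ) (q : ℕ) : ℝ :=
  if q = 0 then 0 else 1 + (2 * (q : ℝ) - 1) * ε

theorem waveTime_nonneg {ε : ℝ} (hε : 0 < ε) (q : ℕ) : 0 ≤ waveTime ε q := by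
  unfold waveTime
  split_ifs with h
  · exact le_rfl
  · have h1 : (1 : ℝ) ≤ q := by exact_mod_cast Nat.one_le_iff_ne_zero.mpr h
    nlinarith

theorem waveTime_mono {ε : ℝ} (hε : 0 < ε) : Monotone (waveTime ε) := by
  intro a b hab
  by_cases ha : a = 0
  · subst ha
    simpa [waveTime] using waveTime_nonneg hε b
  · have hb : b ≠ 0 := by omega
    have h1 : (a : ℝ) ≤ b := by exact_mod_cast hab
    simp only [waveTime, ha, hb, if_false]
    nlinarith

/-- The instance with `m / k` waves of `k` requests each; in every wave one request arrives at each
of the `k` points `0, w, 2 w, …, (k - 1) w` of the line. -/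
noncomputable def sigmaL {k m : ℕ} (hkm : k ∣ m) (w : ℝ) {ε : ℝ} (hε : 0 < ε) :
    MPMDInstance ℝ k m where
  atime := fun n => waveTime ε (n.val / k)
  pos := fun n => w * ((n.val % k : ℕ) : ℝ)
  atime_nonneg := fun _ => waveTime_nonneg hε _
  atime_mono := fun _ _ h => waveTime_mono hε (Nat.div_le_div_right h)
  dvd := hkm

theorem dvd_of_eq_mul_sq {k s m : ℕ} (hm : m = s * k ^ 2) : k ∣ m :=
  hm ▸ Dvd.dvd.mul_left (dvd_pow_self k two_ne_zero) s

end Line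

/-! Whatever choices it makes, the algorithm matches every wave by itself, although matching
requests at the same point would be far cheaper. Divide all dual values by the growth rate. A free
request that is alone in its active set accumulates exactly its waiting time. At time `1` every
request of the first wave has value `1`, so neighbouring points, which are at price `2`, become
tight; the whole wave merges and is matched. From then on its values are frozen, since no free
request remains. A later wave arrives `ε` after its predecessor was matched. At each point the
frozen value of the predecessor pays for all but `ε` of the time between the two arrivals, so the
new request becomes tight with it after waiting exactly `ε`. The old requests link the new wave
together, and its `k` requests are the only free ones.

The invariant `WavesMatched` expresses this. It is preserved by every step (`WavesMatched.step`),
which determines all outputs (`IsGDOutput.eq_waves`), and a potential argument shows that a complete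
run exists (`WavesMatched.exists_final`). Each wave then costs at least its diameter `w (k - 1)`,
and there are `m / k` waves. Offline, grouping `k` consecutive waves point by point has no distance
cost and waiting cost at most `k + m (k - 1) ε` (`blockSchedule_cost_le`). -/

/-! ### Waves, their arrival times and their matching times. -/

/-- The requests of wave number `q`. -/
def wave (k m q : ℕ) : Finset (Fin m) := Finset.univ.filter fun v => v.val / k = q

theorem mem_wave {k m q : ℕ} {v : Fin m} : v ∈ wave k m q ↔ v.val / k = q := by simp [wave]

theorem card_wave_le {k : ℕ} (hk : 0 < k) (m q : ℕ) : (wave k m q).card ≤ k := by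
  have h : (wave k m q).card ≤ (Finset.range k).card := by
    refine Finset.card_le_card_of_injOn (fun v => v.val % k) ?_ ?_
    · intro v _
      simpa using Nat.mod_lt _ hk
    · intro u hu v hv huv
      have hu' := mem_wave.1 hu
      have hv' := mem_wave.1 hv
      apply Fin.ext
      rw [← Nat.div_add_mod u.val k, ← Nat.div_add_mod v.val k, hu', hv']
      simpa using huv
  simpa using h

theorem card_wave {k m N q : ℕ} (hk : 0 < k) (hm : m = N * k) (hq : q < N) :
    (wave k m q).card = k := by
  refine le_antisymm (card_wave_le hk m q) ?_
  have hlt : ∀ a : Fin k, q * k + a.val < m := fun a => by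
    have := Nat.mul_le_mul_right k (Nat.succ_le_of_lt hq)
    have := a.isLt
    rw [Nat.succ_mul] at *
    omega
  have h := Finset.card_le_card_of_injOn (s := (Finset.univ : Finset (Fin k))) (t := wave k m q)
    (fun a => ⟨q * k + a.val, hlt a⟩) ?_ ?_
  · simpa using h
  · intro a _
    simp only [Finset.mem_coe, mem_wave]
    rw [Nat.mul_comm, Nat.mul_add_div hk, Nat.div_eq_of_lt a.isLt, add_zero]
  · intro a _ b _ hab
    simp only [Fin.mk.injEq] at hab
    exact Fin.ext (by omega)

theorem wave_nonempty {k m N q : ℕ} (hk : 0 < k) (hm : m = N * k) (hq : q < N) :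
    (wave k m q).Nonempty := by
  rw [← Finset.card_pos, card_wave hk hm hq]
  exact hk

theorem div_lt_waves {k m N : ℕ} (hm : m = N * k) (v : Fin m) : v.val / k < N := by
  apply Nat.div_lt_of_lt_mul
  have := v.isLt
  rw [Nat.mul_comm]
  omega

theorem waveTime_succ (ε : ℝ) (q : ℕ) : waveTime ε (q + 1) = 1 + (2 * (q : ℝ) + 1) * ε := by
  simp only [waveTime, Nat.add_eq_zero_iff, one_ne_zero, and_false, if_false]
  push_cast
  ring

/-- The time at which wave number `q` is matched. -/
noncomputable def matchTime (ε : ℝ) (q : ℕ) : ℝ := 1 + 2 * (q : ℝ) * ε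

/-- The waiting time of a wave is also the frozen normalised dual value of each of its requests: `1`
for the first wave, `ε` for all later ones. -/
theorem matchTime_sub_zero (ε : ℝ) : matchTime ε 0 - waveTime ε 0 = 1 := by
  simp [matchTime, waveTime]

theorem matchTime_sub_succ (ε : ℝ) (q : ℕ) :
    matchTime ε (q + 1) - waveTime ε (q + 1) = ε := by
  rw [waveTime_succ, matchTime]
  push_cast
  ring

theorem waveTime_lt_matchTime {ε : ℝ} (hε : 0 < ε) (q : ℕ) : waveTime ε q < matchTime ε q := by
  cases q with
  | zero => linarith [matchTime_sub_zero ε]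
  | succ q => linarith [matchTime_sub_succ ε q]

theorem matchTime_sub_le_one {ε : ℝ} (hε : ε ≤ 1) (q : ℕ) :
    matchTime ε q - waveTime ε q ≤ 1 := by
  cases q with
  | zero => linarith [matchTime_sub_zero ε]
  | succ q => linarith [matchTime_sub_succ ε q]

theorem matchTime_add_le_waveTime {ε : ℝ} (hε : 0 < ε) {p q : ℕ} (hpq : p < q) :
    matchTime ε p + ε ≤ waveTime ε q := by
  obtain ⟨q, rfl⟩ : ∃ n, q = n + 1 := ⟨q - 1, by omega⟩
  rw [waveTime_succ, matchTime]
  have : (p : ℝ) ≤ q := by exact_mod_cast Nat.lt_succ_iff.1 hpq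
  nlinarith

theorem waveTime_succ_eq (ε : ℝ) (q : ℕ) : waveTime ε (q + 1) = matchTime ε q + ε := by
  rw [waveTime_succ, matchTime]
  ring

theorem waveTime_strictMono {ε : ℝ} (hε : 0 < ε) {p q : ℕ} (hpq : p < q) :
    waveTime ε p < waveTime ε q := by
  linarith [waveTime_lt_matchTime hε p, matchTime_add_le_waveTime hε hpq]

/-! ### The invariant of a run. -/

/-- Exactly the waves before wave number `q` have been matched, wave `p` at time `matchTime ε p`. -/
structure WavesMatched {m : ℕ} (k : ℕ) (ε : ℝ) (q : ℕ) (X : GDState m) : Prop where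
  groups : X.sched.groups = (Finset.range q).image (wave k m)
  mtime : ∀ p, p < q → X.sched.mtime (wave k m p) = matchTime ε p
  arrived_of_lt : ∀ v : Fin m, v.val / k < q → v ∈ X.arrived
  le_of_arrived : ∀ v ∈ X.arrived, v.val / k ≤ q
  -- Larger active sets with a free request exist only at a matching time, and no time passes before
  -- the wave is matched.
  y_zero : ∀ S, (∀ v, S ≠ {v}) → X.y S = 0
  y_old : ∀ v : Fin m, v.val / k < q →
    X.y {v} = 1 / (1 * (k : ℝ) ^ 2) * (matchTime ε (v.val / k) - waveTime ε (v.val / k))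
  y_current : ∀ v ∈ X.arrived, v.val / k = q →
    X.y {v} = 1 / (1 * (k : ℝ) ^ 2) * (X.time - waveTime ε q)
  mem_self : ∀ v ∈ X.arrived, v ∈ X.A v
  arrived_of_mem : ∀ v ∈ X.arrived, ∀ w ∈ X.A v, w ∈ X.arrived
  A_eq_of_mem : ∀ v ∈ X.arrived, ∀ w ∈ X.A v, X.A w = X.A v
  -- The inequality is strict: at the matching time itself some mergers may already have happened
  -- while the wave is still free.
  single : ∀ v ∈ X.arrived, v.val / k = q → X.time < matchTime ε q → X.A v = {v}
  -- The bounds on the clock are conditional on a request of wave `q`, so they become vacuous after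
  -- the last wave. The nonemptiness guard in `not_subset` has the same purpose.
  waveTime_le : ∀ v ∈ X.arrived, v.val / k = q → waveTime ε q ≤ X.time
  le_matchTime : ∀ v ∈ X.arrived, v.val / k = q → X.time ≤ matchTime ε q
  le_waveTime : ∀ v, v ∉ X.arrived → v.val / k = q → X.time ≤ waveTime ε q
  not_subset : (wave k m q).Nonempty → ∀ u ∈ X.arrived, ¬ wave k m q ⊆ X.A u

theorem wavesMatched_init (k m : ℕ) (ε : ℝ) :
    WavesMatched k ε 0 (GDState.init m) where
  groups := by simp [GDState.init]
  mtime := by simp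
  arrived_of_lt := by simp
  le_of_arrived := by simp [GDState.init]
  y_zero := by simp [GDState.init]
  y_old := by simp
  y_current := by simp [GDState.init]
  mem_self := by simp [GDState.init]
  arrived_of_mem := by simp [GDState.init]
  A_eq_of_mem := by simp [GDState.init]
  single := by simp [GDState.init]
  waveTime_le := by simp [GDState.init]
  le_matchTime := by simp [GDState.init]
  le_waveTime := by simp [GDState.init, waveTime]
  not_subset := by simp [GDState.init]

/-- If only singletons carry a dual value, then a pair sees just the values of its two members. -/
theorem sum_separating {m : ℕ} {y : Finset (Fin m) → ℝ} (hy : ∀ S, (∀ v, S ≠ {v}) → y S = 0)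
    {u v : Fin m} (huv : u ≠ v) :
    ∑ S ∈ Finset.univ.filter (fun S : Finset (Fin m) => ¬ (u ∈ S ↔ v ∈ S)), y S =
      y {u} + y {v} := by
  have hne : ({u} : Finset (Fin m)) ≠ {v} := fun h => huv (Finset.singleton_injective h)
  rw [← Finset.sum_pair hne]
  symm
  apply Finset.sum_subset
  · intro S hS
    simp only [Finset.mem_insert, Finset.mem_singleton] at hS
    rcases hS with rfl | rfl
    · simp [huv.symm]
    · simp [huv]
  · intro S hS hS'
    apply hy
    rintro w rfl
    simp only [Finset.mem_filter, Finset.mem_univ, true_and, Finset.mem_singleton] at hS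
    simp only [Finset.mem_insert, Finset.mem_singleton, Finset.singleton_inj, not_or] at hS'
    exact hS ⟨fun h => absurd h.symm hS'.1, fun h => absurd h.symm hS'.2⟩

/-! ### Which pairs are tight, and when. -/

namespace WavesMatched

variable {k m N q : ℕ} {ε w : ℝ} {X : GDState m} {ρ : ℝ → ℝ → ℝ} {hε : 0 < ε} {hkm : k ∣ m}

theorem mem_free (h : WavesMatched k ε q X) {S : Finset (Fin m)} {v : Fin m} :
    v ∈ X.free S ↔ v ∈ S ∧ q ≤ v.val / k := by
  rw [GDState.free, Finset.mem_filter, h.groups]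
  simp only [Finset.mem_image, Finset.mem_range, forall_exists_index, and_imp,
    forall_apply_eq_imp_iff₂, mem_wave]
  refine and_congr_right fun _ => ⟨fun H => ?_, fun H p hp hv => ?_⟩
  · by_contra hlt
    exact H _ (not_le.1 hlt) rfl
  · omega

theorem pairOptCost_eq (hρ : ∀ i j : ℕ, ρ (w * i) (w * j) = 2 * |(i : ℝ) - j|) (u v : Fin m) :
    pairOptCost ρ (sigmaL hkm w hε) u v =
      2 * |((u.val % k : ℕ) : ℝ) - ((v.val % k : ℕ) : ℝ)| +
        |waveTime ε (u.val / k) - waveTime ε (v.val / k)| := by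
  simp only [pairOptCost, sigmaL, hρ]

/-- Tightness in terms of the normalised dual values. -/
theorem isTight_iff (h : WavesMatched k ε q X) (hk : 2 ≤ k)
    (hρ : ∀ i j : ℕ, ρ (w * i) (w * j) = 2 * |(i : ℝ) - j|) {u v : Fin m} (huv : u ≠ v)
    {a b : ℝ} (ha : X.y {u} = 1 / (1 * (k : ℝ) ^ 2) * a)
    (hb : X.y {v} = 1 / (1 * (k : ℝ) ^ 2) * b) :
    X.IsTight ρ 1 (sigmaL hkm w hε) u v ↔
      a + b = 2 * |((u.val % k : ℕ) : ℝ) - ((v.val % k : ℕ) : ℝ)| +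
        |waveTime ε (u.val / k) - waveTime ε (v.val / k)| := by
  have hr : (1 : ℝ) / (1 * (k : ℝ) ^ 2) ≠ 0 := by
    have : (k : ℝ) ≠ 0 := by positivity
    positivity
  rw [GDState.IsTight, sum_separating h.y_zero huv, ha, hb, pairOptCost_eq hρ, ← mul_add]
  exact mul_right_inj' hr

theorem two_le_dist {u v : Fin m} (huv : u ≠ v) (hW : u.val / k = v.val / k) :
    (2 : ℝ) ≤ 2 * |((u.val % k : ℕ) : ℝ) - ((v.val % k : ℕ) : ℝ)| := by
  have hne : u.val % k ≠ v.val % k := by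
    intro hmod
    apply huv
    apply Fin.ext
    rw [← Nat.div_add_mod u.val k, ← Nat.div_add_mod v.val k, hW, hmod]
  have h1 : (1 : ℤ) ≤ |((u.val % k : ℕ) : ℤ) - ((v.val % k : ℕ) : ℤ)| := by
    apply Int.one_le_abs
    omega
  have h2 : (1 : ℝ) ≤ |((u.val % k : ℕ) : ℝ) - ((v.val % k : ℕ) : ℝ)| := by exact_mod_cast h1
  linarith

theorem isTight_comm {χ : Type*} {ρ : χ → χ → ℝ} {σ : MPMDInstance χ k m} {γ : ℝ}
    (hρ : ∀ u v, pairOptCost ρ σ u v = pairOptCost ρ σ v u) {u v : Fin m} :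
    X.IsTight ρ γ σ u v ↔ X.IsTight ρ γ σ v u := by
  simp only [GDState.IsTight, hρ u v, iff_comm (a := u ∈ _)]

theorem pairOptCost_comm (hρ : ∀ i j : ℕ, ρ (w * i) (w * j) = 2 * |(i : ℝ) - j|) (u v : Fin m) :
    pairOptCost ρ (sigmaL hkm w hε) u v = pairOptCost ρ (sigmaL hkm w hε) v u := by
  rw [pairOptCost_eq hρ, pairOptCost_eq hρ, abs_sub_comm, abs_sub_comm (waveTime _ _)]

/-- Against an older request, the current one still lacks part of the `ε` by which the time gap
exceeds the frozen value. Within the wave, both values are below `1`, because `ε ≤ 1`, while the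
price is at least `2`. -/
theorem not_isTight (h : WavesMatched k ε q X) (hk : 2 ≤ k) (hε1 : ε ≤ 1)
    (hρ : ∀ i j : ℕ, ρ (w * i) (w * j) = 2 * |(i : ℝ) - j|) {u v : Fin m} (huv : u ≠ v)
    (hu : u ∈ X.arrived) (hv : v ∈ X.arrived) (huq : u.val / k = q)
    (htime : X.time < matchTime ε q) :
    ¬ X.IsTight ρ 1 (sigmaL hkm w hε) u v := by
  rcases (h.le_of_arrived v hv).lt_or_eq with hlt | heq
  · rw [h.isTight_iff hk hρ huv (h.y_current u hu huq) (h.y_old v hlt), huq]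
    obtain ⟨p, rfl⟩ : ∃ n, q = n + 1 :=
      Nat.exists_eq_succ_of_ne_zero (Nat.ne_zero_of_lt hlt)
    have h1 := matchTime_sub_succ ε p
    have h2 := matchTime_add_le_waveTime hε hlt
    have h3 := le_abs_self (waveTime ε (p + 1) - waveTime ε (v.val / k))
    have h4 := abs_nonneg (((u.val % k : ℕ) : ℝ) - ((v.val % k : ℕ) : ℝ))
    intro h5
    linarith
  · rw [h.isTight_iff hk hρ huv (h.y_current u hu huq) (h.y_current v hv heq), huq, heq]
    have h1 := matchTime_sub_le_one hε1 q
    have h2 := two_le_dist huv (huq.trans heq.symm)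
    have h3 := abs_nonneg (waveTime ε q - waveTime ε q)
    intro h5
    linarith

/-- At the matching time of a wave all requests are connected by tight pairs. -/
theorem hasMergeablePair (h : WavesMatched k ε q X) (hk : 2 ≤ k) (hm : m = N * k) (hq : q < N)
    (hρ : ∀ i j : ℕ, ρ (w * i) (w * j) = 2 * |(i : ℝ) - j|)
    (harr : ∀ v : Fin m, v.val / k = q → v ∈ X.arrived) (htime : X.time = matchTime ε q) :
    X.HasMergeablePair ρ 1 (sigmaL hkm w hε) := by
  have hk0 : 0 < k := by omega
  have hm0 : 0 < m := hm ▸ Nat.mul_pos (by omega) hk0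
  have harr' : ∀ v : Fin m, v.val / k ≤ q → v ∈ X.arrived := fun v hv =>
    hv.lt_or_eq.elim (h.arrived_of_lt v) (harr v)
  have hy : ∀ v : Fin m, v.val / k ≤ q →
      X.y {v} = 1 / (1 * (k : ℝ) ^ 2) *
        (matchTime ε (v.val / k) - waveTime ε (v.val / k)) := by
    intro v hv
    rcases hv.lt_or_eq with hlt | heq
    · exact h.y_old v hlt
    · rw [h.y_current v (harr v heq) heq, htime, heq]
  -- Without a mergeable pair, tightness implies equality of active sets. Chains of tight pairs then
  -- put all arrived requests into one set, contradicting `not_subset`.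
  by_contra hno
  have heq : ∀ u v : Fin m, u.val / k ≤ q → v.val / k ≤ q →
      X.IsTight ρ 1 (sigmaL hkm w hε) u v → X.A u = X.A v := by
    intro u v hu hv ht
    by_contra hne
    exact hno ⟨u, harr' u hu, v, harr' v hv, hne, ht⟩
  have key : ∀ n : ℕ, ∀ v : Fin m, v.val = n → v.val / k ≤ q → X.A v = X.A ⟨0, hm0⟩ := by
    intro n
    induction n using Nat.strong_induction_on with
    | _ n ih =>
      intro v hvn hvq
      rcases Nat.eq_zero_or_pos n with hn | hn
      · congr 1
        exact Fin.ext (by simp [hvn, hn])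
      -- In the first wave the chain goes to the neighbouring point (`1 + 1 = 2`); in a later wave
      -- it goes to the same point one wave earlier, `k` indices before.
      · by_cases hlt : v.val < k
        · have hu : v.val - 1 < m := by omega
          have hu0 : (v.val - 1) / k = 0 := Nat.div_eq_of_lt (by omega)
          have hv0 : v.val / k = 0 := Nat.div_eq_of_lt hlt
          rw [← ih (v.val - 1) (by omega) ⟨v.val - 1, hu⟩ rfl (by simp [hu0])]
          refine heq _ _ hvq (by simp [hu0]) ?_
          have hne : v ≠ ⟨v.val - 1, hu⟩ := fun hh => by
            have := congrArg Fin.val hh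
            simp only at this
            omega
          rw [h.isTight_iff hk hρ hne (hy _ hvq) (hy _ (by simp [hu0]))]
          simp only [hu0, hv0, matchTime_sub_zero, Nat.mod_eq_of_lt hlt,
            Nat.mod_eq_of_lt (show v.val - 1 < k by omega)]
          rw [Nat.cast_sub (by omega)]
          norm_num
        · have hu : v.val - k < m := by omega
          have hmod : (v.val - k) % k = v.val % k := (Nat.mod_eq_sub_mod (by omega)).symm
          obtain ⟨p, hp⟩ : ∃ p, v.val / k = p + 1 :=
            ⟨v.val / k - 1, by have := Nat.div_pos (not_lt.1 hlt) hk0; omega⟩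
          have hdiv : (v.val - k) / k = p := by
            rw [Nat.div_eq_sub_div hk0 (not_lt.1 hlt)] at hp
            omega
          rw [← ih (v.val - k) (by omega) ⟨v.val - k, hu⟩ rfl (by simp only [hdiv]; omega)]
          refine heq _ _ hvq (by simp only [hdiv]; omega) ?_
          have hne : v ≠ ⟨v.val - k, hu⟩ := fun hh => by
            have := congrArg Fin.val hh
            simp only at this
            omega
          rw [h.isTight_iff hk hρ hne (hy _ hvq) (hy _ (by simp only [hdiv]; omega))]
          simp only [hdiv, hp, hmod, sub_self, abs_zero, mul_zero, zero_add, matchTime_sub_succ]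
          rw [abs_of_nonneg (sub_nonneg.2 (waveTime_mono hε (Nat.le_succ p))), waveTime_succ_eq]
          ring
  obtain ⟨v, hv⟩ := wave_nonempty hk0 hm hq
  rw [mem_wave] at hv
  refine h.not_subset ⟨v, mem_wave.2 hv⟩ v (harr v hv) fun x hx => ?_
  rw [mem_wave] at hx
  rw [key _ v rfl hv.le, ← key _ x rfl hx.le]
  exact h.mem_self x (harr x hx)

/-! ### Preservation of the invariant by the steps of the algorithm. -/

theorem arrive (h : WavesMatched k ε q X) (hk : 2 ≤ k) (hm : m = N * k) (hε' : 0 < ε) {v : Fin m}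
    (hnew : v ∉ X.arrived) (htime : waveTime ε (v.val / k) = X.time) :
    WavesMatched k ε q (X.arrive v) := by
  have hk0 : 0 < k := by omega
  have hvq : v.val / k = q := by
    have hge : q ≤ v.val / k := not_lt.1 fun hlt => hnew (h.arrived_of_lt v hlt)
    -- Whether or not a given request of wave `q` has arrived, the clock is still strictly before
    -- the arrival of any later wave.
    by_contra hne
    have hlt : q < v.val / k := by omega
    obtain ⟨x, hx⟩ := wave_nonempty hk0 hm (hlt.trans (div_lt_waves hm v))
    rw [mem_wave] at hx
    by_cases hxa : x ∈ X.arrived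
    · linarith [h.le_matchTime x hxa hx, matchTime_add_le_waveTime hε' hlt]
    · linarith [h.le_waveTime x hxa hx, waveTime_strictMono hε' hlt]
  have htq : X.time = waveTime ε q := by rw [← htime, hvq]
  have hnv : ∀ u ∈ X.arrived, u ≠ v := fun u hu huv => hnew (huv ▸ hu)
  have hnA : ∀ u ∈ X.arrived, v ∉ X.A u := fun u hu hv => hnew (h.arrived_of_mem u hu v hv)
  refine ⟨h.groups, h.mtime, ?_, ?_, ?_, ?_, ?_, ?_, ?_, ?_, ?_, ?_, ?_, ?_, ?_⟩ <;>
    simp only [GDState.arrive, Finset.mem_insert]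
  · exact fun u hu => Or.inr (h.arrived_of_lt u hu)
  · rintro u (rfl | hu)
    · exact hvq.le
    · exact h.le_of_arrived u hu
  · intro S hS
    split_ifs
    · rfl
    · exact h.y_zero S hS
  · intro u hu
    have : u ≠ v := hnv u (h.arrived_of_lt u hu)
    simpa [this.symm] using h.y_old u hu
  · rintro u (rfl | hu) huq
    · simp [htq]
    · simpa [(hnv u hu).symm] using h.y_current u hu huq
  · rintro u (rfl | hu)
    · simp
    · simpa [hnv u hu] using h.mem_self u hu
  · rintro u (rfl | hu) x hx
    · simp only [Function.update_self, Finset.mem_singleton] at hx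
      exact Or.inl hx
    · rw [Function.update_of_ne (hnv u hu)] at hx
      exact Or.inr (h.arrived_of_mem u hu x hx)
  · rintro u (rfl | hu) x hx
    · simp only [Function.update_self, Finset.mem_singleton] at hx
      rw [hx]
    · rw [Function.update_of_ne (hnv u hu)] at hx ⊢
      rw [Function.update_of_ne (hnv x (h.arrived_of_mem u hu x hx))]
      exact h.A_eq_of_mem u hu x hx
  · rintro u (rfl | hu) huq hlt
    · simp
    · rw [Function.update_of_ne (hnv u hu)]
      exact h.single u hu huq hlt
  · exact fun u _ _ => htq.ge
  · exact fun u _ _ => htq ▸ (waveTime_lt_matchTime hε' q).le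
  · exact fun u _ _ => htq.le
  -- The new singleton is too small to contain a wave, as `k ≥ 2`, and no older active set contains
  -- the new request.
  · rintro - u (rfl | hu) hsub
    · rw [Function.update_self] at hsub
      have h1 := Finset.card_le_card hsub
      rw [card_wave hk0 hm (hvq ▸ div_lt_waves hm u), Finset.card_singleton] at h1
      omega
    · rw [Function.update_of_ne (hnv u hu)] at hsub
      exact hnA u hu (hsub (mem_wave.2 hvq))

/-- The active sets with a free request are exactly the singletons of arrived requests of wave `q`,
so these alone grow. -/
theorem advance (h : WavesMatched k ε q X) {Δ : ℝ} (hΔ : 0 ≤ Δ)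
    (harr : ∀ v, v ∉ X.arrived → v.val / k = q → X.time + Δ ≤ waveTime ε q)
    (hle : ∀ v ∈ X.arrived, v.val / k = q → X.time + Δ ≤ matchTime ε q) :
    WavesMatched k ε q (X.advance k 1 Δ) := by
  -- For `Δ = 0` the clock may already stand at the matching time, where `single` gives nothing.
  rcases hΔ.eq_or_lt with rfl | hpos
  · have : X.advance k 1 0 = X := by
      simp [GDState.advance]
    rwa [this]
  have hact : ∀ S, X.IsActive S ∧ (X.free S).Nonempty ↔
      ∃ v ∈ X.arrived, v.val / k = q ∧ S = {v} := by
    intro S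
    constructor
    · rintro ⟨⟨u, hu, rfl⟩, v, hv⟩
      obtain ⟨hvA, hvq⟩ := h.mem_free.1 hv
      have hva := h.arrived_of_mem u hu v hvA
      have hvq' := le_antisymm (h.le_of_arrived v hva) hvq
      refine ⟨v, hva, hvq', ?_⟩
      rw [← h.A_eq_of_mem u hu v hvA]
      exact h.single v hva hvq' (by linarith [hle v hva hvq'])
    · rintro ⟨v, hv, hvq, rfl⟩
      refine ⟨⟨v, hv, h.single v hv hvq (by linarith [hle v hv hvq])⟩, v, ?_⟩
      rw [h.mem_free]
      simp [hvq]
  refine ⟨h.groups, h.mtime, h.arrived_of_lt, h.le_of_arrived, ?_, ?_, ?_, h.mem_self,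
    h.arrived_of_mem, h.A_eq_of_mem, ?_, ?_, hle, harr, h.not_subset⟩
  · intro S hS
    have : ¬ (X.IsActive S ∧ (X.free S).Nonempty) := by
      rw [hact]
      rintro ⟨v, -, -, rfl⟩
      exact hS v rfl
    simpa only [GDState.advance, if_neg this] using h.y_zero S hS
  · intro v hv
    have : ¬ (X.IsActive {v} ∧ (X.free {v}).Nonempty) := by
      rw [hact]
      rintro ⟨u, -, huq, huv⟩
      rw [Finset.singleton_inj] at huv
      subst huv
      omega
    simpa only [GDState.advance, if_neg this] using h.y_old v hv
  · intro v hv hvq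
    have : X.IsActive {v} ∧ (X.free {v}).Nonempty := (hact _).2 ⟨v, hv, hvq, rfl⟩
    simp only [GDState.advance, if_pos this]
    rw [h.y_current v hv hvq]
    ring
  · intro v hv hvq hlt
    exact h.single v hv hvq (by simp only [GDState.advance] at hlt; linarith)
  · intro v hv hvq
    have := h.waveTime_le v hv hvq
    simp only [GDState.advance]
    linarith

/-- Before its matching time a request of the current wave takes part in no merger. -/
theorem not_mem_union (h : WavesMatched k ε q X) (hk : 2 ≤ k) (hε1 : ε ≤ 1)
    (hρ : ∀ i j : ℕ, ρ (w * i) (w * j) = 2 * |(i : ℝ) - j|) {u v x : Fin m}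
    (hu : u ∈ X.arrived) (hv : v ∈ X.arrived) (hne : X.A u ≠ X.A v)
    (htight : X.IsTight ρ 1 (sigmaL hkm w hε) u v) (hx : x ∈ X.arrived) (hxq : x.val / k = q)
    (hlt : X.time < matchTime ε q) : x ∉ X.A u ∪ X.A v := by
  have huv : u ≠ v := fun huv => hne (huv ▸ rfl)
  have hA := h.single x hx hxq hlt
  rw [Finset.mem_union]
  rintro (hxu | hxv)
  · have hmem := h.mem_self u hu
    rw [← h.A_eq_of_mem u hu x hxu, hA, Finset.mem_singleton] at hmem
    subst hmem
    exact h.not_isTight hk hε1 hρ huv hu hv hxq hlt htight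
  · have hmem := h.mem_self v hv
    rw [← h.A_eq_of_mem v hv x hxv, hA, Finset.mem_singleton] at hmem
    subst hmem
    exact h.not_isTight hk hε1 hρ huv.symm hv hu hxq hlt
      ((isTight_comm (pairOptCost_comm hρ)).1 htight)

theorem free_union_subset (h : WavesMatched k ε q X) {u v : Fin m}
    (hu : u ∈ X.arrived) (hv : v ∈ X.arrived) :
    X.free (X.A u ∪ X.A v) ⊆ wave k m q := by
  intro x hx
  obtain ⟨hxU, hxq⟩ := h.mem_free.1 hx
  have hxa : x ∈ X.arrived := (Finset.mem_union.1 hxU).elim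
    (h.arrived_of_mem u hu x) (h.arrived_of_mem v hv x)
  exact mem_wave.2 (le_antisymm (h.le_of_arrived x hxa) hxq)

/-- The free requests of the union lie in wave `q`. Either part of the wave is missing and no group
can be formed, or the wave is complete and the rule of the algorithm forces it to be matched as one
group. -/
theorem merge (h : WavesMatched k ε q X) (hk : 2 ≤ k) (hε1 : ε ≤ 1)
    (hρ : ∀ i j : ℕ, ρ (w * i) (w * j) = 2 * |(i : ℝ) - j|) {u v : Fin m}
    (hu : u ∈ X.arrived) (hv : v ∈ X.arrived) (hne : X.A u ≠ X.A v)
    (htight : X.IsTight ρ 1 (sigmaL hkm w hε) u v) {P : Finset (Finset (Fin m))}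
    (hP : ∀ F ∈ P, F ⊆ X.free (X.A u ∪ X.A v) ∧ F.card = k)
    (hrest : (X.free (X.A u ∪ X.A v) \ P.biUnion id).card < k)
    (hm : m = N * k) :
    WavesMatched k ε q (X.merge u v P) ∨ q < N ∧ WavesMatched k ε (q + 1) (X.merge u v P) := by
  have hk0 : 0 < k := by omega
  have hnU := fun x => h.not_mem_union (x := x) hk hε1 hρ hu hv hne htight
  set U := X.A u ∪ X.A v with hU
  have hUarr : ∀ x ∈ U, x ∈ X.arrived := fun x hx => (Finset.mem_union.1 hx).elim
    (h.arrived_of_mem u hu x) (h.arrived_of_mem v hv x)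
  -- Active sets are the classes of a partition, so a class that meets the union of two classes is
  -- contained in it.
  have hUA : ∀ x ∈ X.arrived, ∀ z ∈ X.A x, z ∈ U → x ∈ U := by
    intro x hx z hz hzU
    have hxz : x ∈ X.A z := (h.A_eq_of_mem x hx z hz).symm ▸ h.mem_self x hx
    rcases Finset.mem_union.1 hzU with hzu | hzv
    · exact Finset.mem_union_left _ (h.A_eq_of_mem u hu z hzu ▸ hxz)
    · exact Finset.mem_union_right _ (h.A_eq_of_mem v hv z hzv ▸ hxz)
  have hFw : ∀ F ∈ P, F = wave k m q := fun F hF =>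
    Finset.eq_of_subset_of_card_le ((hP F hF).1.trans (h.free_union_subset hu hv))
      ((hP F hF).2.symm ▸ card_wave_le hk0 m q)
  have hmem_self : ∀ x ∈ X.arrived, x ∈ if x ∈ U then U else X.A x := by
    intro x hx
    split_ifs with hxU
    · exact hxU
    · exact h.mem_self x hx
  have harr : ∀ x ∈ X.arrived, ∀ z ∈ (if x ∈ U then U else X.A x), z ∈ X.arrived := by
    intro x hx z hz
    split_ifs at hz
    · exact hUarr z hz
    · exact h.arrived_of_mem x hx z hz
  have hAeq : ∀ x ∈ X.arrived, ∀ z ∈ (if x ∈ U then U else X.A x),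
      (if z ∈ U then U else X.A z) = if x ∈ U then U else X.A x := by
    intro x hx z hz
    by_cases hxU : x ∈ U
    · rw [if_pos hxU] at hz ⊢
      rw [if_pos hz]
    · rw [if_neg hxU] at hz ⊢
      rw [if_neg fun hzU => hxU (hUA x hx z hz hzU)]
      exact h.A_eq_of_mem x hx z hz
  have hsingle : ∀ x ∈ X.arrived, x.val / k = q → X.time < matchTime ε q →
      (if x ∈ U then U else X.A x) = {x} := by
    intro x hx hxq hlt
    rw [if_neg (hnU x hx hxq hlt)]
    exact h.single x hx hxq hlt
  by_cases hsub : wave k m q ⊆ U ∧ (wave k m q).Nonempty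
  · right
    obtain ⟨hsub, x₀, hx₀⟩ := hsub
    rw [mem_wave] at hx₀
    have hqN : q < N := hx₀ ▸ div_lt_waves hm x₀
    have harrq : ∀ x : Fin m, x.val / k = q → x ∈ X.arrived := fun x hx =>
      hUarr x (hsub (mem_wave.2 hx))
    have hfree : X.free U = wave k m q :=
      (h.free_union_subset hu hv).antisymm fun x hx =>
        h.mem_free.2 ⟨hsub hx, (mem_wave.1 hx).ge⟩
    have hPw : P = {wave k m q} := by
      rw [Finset.eq_singleton_iff_nonempty_unique_mem]
      refine ⟨?_, hFw⟩
      rw [Finset.nonempty_iff_ne_empty]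
      rintro rfl
      rw [hfree, Finset.biUnion_empty, Finset.sdiff_empty, card_wave hk0 hm hqN] at hrest
      exact hrest.false
    -- Requests of the current wave take part in mergers only at its matching time.
    have htime : X.time = matchTime ε q := by
      refine le_antisymm (h.le_matchTime x₀ (harrq x₀ hx₀) hx₀) (not_lt.1 fun hlt => ?_)
      exact hnU x₀ (harrq x₀ hx₀) hx₀ hlt (hsub (mem_wave.2 hx₀))
    have hnew : ∀ x ∈ X.arrived, x.val / k ≠ q + 1 := fun x hx hxq => by
      have := h.le_of_arrived x hx
      omega
    refine ⟨hqN, ?_, ?_, ?_, ?_, h.y_zero, ?_, ?_, hmem_self, harr, hAeq, ?_, ?_, ?_, ?_, ?_⟩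
    · simp only [GDState.merge]
      rw [h.groups, hPw, Finset.range_add_one, Finset.image_insert, Finset.union_comm]
      rfl
    · intro p hp
      simp only [GDState.merge, hPw, Finset.mem_singleton]
      rcases (Nat.lt_succ_iff.1 hp).lt_or_eq with hlt | rfl
      · rw [if_neg, h.mtime p hlt]
        intro heq
        have : x₀ ∈ wave k m p := heq ▸ mem_wave.2 hx₀
        rw [mem_wave] at this
        omega
      · rw [if_pos rfl, htime]
    · intro x hx
      rcases (Nat.lt_succ_iff.1 hx).lt_or_eq with hlt | heq
      · exact h.arrived_of_lt x hlt
      · exact harrq x heq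
    · exact fun x hx => (h.le_of_arrived x hx).trans (Nat.le_succ q)
    · intro x hx
      rcases (Nat.lt_succ_iff.1 hx).lt_or_eq with hlt | heq
      · exact h.y_old x hlt
      · simp only [GDState.merge]
        rw [h.y_current x (harrq x heq) heq, htime, heq]
    · exact fun x hx hxq => absurd hxq (hnew x hx)
    · exact fun x hx hxq => absurd hxq (hnew x hx)
    · exact fun x hx hxq => absurd hxq (hnew x hx)
    · exact fun x hx hxq => absurd hxq (hnew x hx)
    · intro x _ _
      simp only [GDState.merge]
      rw [htime, waveTime_succ_eq]
      linarith
    · rintro ⟨z, hz⟩ x hx hs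
      exact hnew z (harr x hx z (hs hz)) (mem_wave.1 hz)
  · left
    have hPe : P = ∅ := by
      rw [Finset.eq_empty_iff_forall_notMem]
      intro F hF
      have hFs := (hP F hF).1
      have hFc := (hP F hF).2
      rw [hFw F hF] at hFs hFc
      refine hsub ⟨fun x hx => (h.mem_free.1 (hFs hx)).1, ?_⟩
      rw [← Finset.card_pos]
      omega
    subst hPe
    refine ⟨?_, ?_, h.arrived_of_lt, h.le_of_arrived, h.y_zero, h.y_old, h.y_current, hmem_self,
      harr, hAeq, hsingle, h.waveTime_le, h.le_matchTime, h.le_waveTime, ?_⟩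
    · simpa only [GDState.merge, Finset.union_empty] using h.groups
    · simpa only [GDState.merge, Finset.notMem_empty, if_false] using h.mtime
    · intro hne x hx hs
      change _ ⊆ (if x ∈ U then U else X.A x) at hs
      split_ifs at hs
      · exact hsub ⟨hs, hne⟩
      · exact h.not_subset hne x hx hs

theorem step (h : WavesMatched k ε q X) (hk : 2 ≤ k) (hε1 : ε ≤ 1)
    (hρ : ∀ i j : ℕ, ρ (w * i) (w * j) = 2 * |(i : ℝ) - j|) (hm : m = N * k) (hq : q ≤ N)
    {X' : GDState m} (hstep : GDStep ρ 1 (sigmaL hkm w hε) X X') :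
    ∃ q' ≤ N, WavesMatched k ε q' X' := by
  cases hstep with
  | arrive v hnew htime horder => exact ⟨q, hq, h.arrive hk hm hε hnew htime⟩
  | merge u v P harr hu hv hne htight hP hdisj hrest =>
    rcases h.merge hk hε1 hρ hu hv hne htight hP hrest hm with h' | ⟨hlt, h'⟩
    · exact ⟨q, hq, h'⟩
    · exact ⟨q + 1, hlt, h'⟩
  | elapse Δ hΔ harr hquiet =>
    have hun : ∀ v, v ∉ X.arrived → v.val / k = q → X.time + Δ ≤ waveTime ε q := by
      intro v hv hvq
      have := harr v hv
      simpa only [sigmaL, hvq] using this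
    refine ⟨q, hq, h.advance hΔ.le hun fun v hv hvq => not_lt.1 fun hlt => ?_⟩
    have hall : ∀ x : Fin m, x.val / k = q → x ∈ X.arrived := by
      intro x hx
      by_contra hxa
      linarith [hun x hxa hx, h.waveTime_le v hv hvq]
    have h0 : 0 ≤ matchTime ε q - X.time := sub_nonneg.2 (h.le_matchTime v hv hvq)
    -- The clock cannot jump past the matching time, since a mergeable pair would appear at that
    -- instant.
    refine hquiet (matchTime ε q - X.time) h0 (by linarith) ?_
    refine (h.advance h0 (fun x hx hxq => absurd (hall x hxq) hx) fun _ _ _ => ?_).hasMergeablePair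
      hk hm (hvq ▸ div_lt_waves hm v) hρ hall ?_
    · linarith
    · simp [GDState.advance]

end WavesMatched

/-! ### Existence of a complete run. -/

namespace WavesMatched

variable {k m N q : ℕ} {ε w : ℝ} {X : GDState m} {ρ : ℝ → ℝ → ℝ} {hε : 0 < ε} {hkm : k ∣ m}

theorem eq_of_complete (h : WavesMatched k ε q X) (hk : 2 ≤ k) (hm : m = N * k) (hq : q ≤ N)
    (hcomp : ∀ v, ∃ F ∈ X.sched.groups, v ∈ F) : q = N := by
  by_contra hne
  obtain ⟨x, hx⟩ := wave_nonempty (by omega) hm (lt_of_le_of_ne hq hne)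
  obtain ⟨F, hF, hxF⟩ := hcomp x
  rw [h.groups] at hF
  simp only [Finset.mem_image, Finset.mem_range] at hF
  obtain ⟨p, hp, rfl⟩ := hF
  rw [mem_wave] at hx hxF
  omega

theorem complete (h : WavesMatched k ε N X) (hm : m = N * k) (v : Fin m) :
    ∃ F ∈ X.sched.groups, v ∈ F := by
  rw [h.groups]
  exact ⟨_, Finset.mem_image_of_mem _ (Finset.mem_range.2 (div_lt_waves hm v)), mem_wave.2 rfl⟩

/-- No arrival is ever missed; an arrival step is possible only at the exact arrival time. -/
theorem time_le (h : WavesMatched k ε q X) (hk : 2 ≤ k) (hm : m = N * k) (hε' : 0 < ε)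
    {v : Fin m} (hv : v ∉ X.arrived) : X.time ≤ waveTime ε (v.val / k) := by
  have hge : q ≤ v.val / k := not_lt.1 fun hlt => hv (h.arrived_of_lt v hlt)
  obtain ⟨x, hx⟩ := wave_nonempty (by omega) hm (hge.trans_lt (div_lt_waves hm v))
  rw [mem_wave] at hx
  by_cases hxa : x ∈ X.arrived
  · rcases hge.eq_or_lt with rfl | hlt
    · exact h.le_waveTime v hv rfl
    · linarith [h.le_matchTime x hxa hx, matchTime_add_le_waveTime hε' hlt]
  · exact (h.le_waveTime x hxa hx).trans (waveTime_mono hε' hge)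

end WavesMatched

/-- The number of events (arrivals and mergers) that lie ahead is bounded in terms of this
quantity. -/
def GDState.potential {m : ℕ} (X : GDState m) : ℕ :=
  2 * X.arrivedᶜ.card + (X.arrived.image X.A).card

/-- An arrival may create one new active set; the weight `2` of a missing request outweighs it. -/
theorem GDState.potential_arrive_lt {m : ℕ} {X : GDState m} {v : Fin m} (hv : v ∉ X.arrived) :
    (X.arrive v).potential < X.potential := by
  have h1 : (insert v X.arrived)ᶜ.card + 1 = X.arrivedᶜ.card := by
    rw [Finset.compl_insert]
    exact Finset.card_erase_add_one (by simpa using hv)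
  have h2 : ((insert v X.arrived).image (Function.update X.A v {v})).card ≤
      (X.arrived.image X.A).card + 1 := by
    refine (Finset.card_le_card ?_).trans (Finset.card_insert_le {v} _)
    intro S hS
    simp only [Finset.mem_image, Finset.mem_insert] at hS ⊢
    obtain ⟨u, rfl | hu, rfl⟩ := hS
    · exact Or.inl (Function.update_self ..)
    · exact Or.inr ⟨u, hu, (Function.update_of_ne (ne_of_mem_of_not_mem hu hv) ..).symm⟩
  simp only [GDState.potential, GDState.arrive]
  omega

namespace WavesMatched

variable {k m N q : ℕ} {ε w : ℝ} {X : GDState m} {ρ : ℝ → ℝ → ℝ} {hε : 0 < ε} {hkm : k ∣ m}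

theorem potential_merge_lt (h : WavesMatched k ε q X) {u v : Fin m} (hu : u ∈ X.arrived)
    (hv : v ∈ X.arrived) (hne : X.A u ≠ X.A v) (P : Finset (Finset (Fin m))) :
    (X.merge u v P).potential < X.potential := by
  have hsub : X.arrived.image (X.merge u v P).A ⊆
      insert (X.A u ∪ X.A v) (((X.arrived.image X.A).erase (X.A u)).erase (X.A v)) := by
    intro S hS
    simp only [Finset.mem_image] at hS
    obtain ⟨x, hx, rfl⟩ := hS
    by_cases hxU : x ∈ X.A u ∪ X.A v
    · simp only [GDState.merge, if_pos hxU, Finset.mem_insert, true_or]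
    · have hxA := h.mem_self x hx
      simp only [GDState.merge, if_neg hxU]
      refine Finset.mem_insert_of_mem (Finset.mem_erase.2 ⟨fun hh => ?_, Finset.mem_erase.2
        ⟨fun hh => ?_, Finset.mem_image_of_mem _ hx⟩⟩)
      · exact hxU (Finset.mem_union_right _ (hh ▸ hxA))
      · exact hxU (Finset.mem_union_left _ (hh ▸ hxA))
  have h1 := (Finset.card_le_card hsub).trans (Finset.card_insert_le _ _)
  have h2 : X.A u ∈ X.arrived.image X.A := Finset.mem_image_of_mem _ hu
  have h3 : X.A v ∈ (X.arrived.image X.A).erase (X.A u) :=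
    Finset.mem_erase.2 ⟨hne.symm, Finset.mem_image_of_mem _ hv⟩
  have h4 := Finset.card_erase_add_one h2
  have h5 := Finset.card_erase_add_one h3
  have h6 : (X.merge u v P).arrived = X.arrived := rfl
  simp only [GDState.potential, h6]
  omega

theorem exists_arrive (h : WavesMatched k ε q X) (hk : 2 ≤ k) (hm : m = N * k) (hq : q ≤ N)
    {v : Fin m} (hv : v ∉ X.arrived) (hvt : waveTime ε (v.val / k) = X.time) :
    ∃ X' : GDState m, ∃ q' ≤ N, GDStep ρ 1 (sigmaL hkm w hε) X X' ∧ WavesMatched k ε q' X' ∧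
      X'.potential < X.potential := by
  -- Arrivals are handled in index order, so the smallest missing request is taken; by monotonicity
  -- of the arrival times it is due now as well.
  have hne : X.arrivedᶜ.Nonempty := ⟨v, Finset.mem_compl.2 hv⟩
  have hmem := X.arrivedᶜ.min'_mem hne
  have hmin : ∀ x, x < X.arrivedᶜ.min' hne → x ∈ X.arrived := fun x hx => by
    by_contra hxa
    exact absurd (X.arrivedᶜ.min'_le x (Finset.mem_compl.2 hxa)) (not_le.2 hx)
  have hle := X.arrivedᶜ.min'_le v (Finset.mem_compl.2 hv)
  set x := X.arrivedᶜ.min' hne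
  rw [Finset.mem_compl] at hmem
  have hxt : waveTime ε (x.val / k) = X.time :=
    le_antisymm (hvt ▸ waveTime_mono hε (Nat.div_le_div_right hle)) (h.time_le hk hm hε hmem)
  exact ⟨X.arrive x, q, hq, GDStep.arrive X x hmem hxt hmin, h.arrive hk hm hε hmem hxt,
    GDState.potential_arrive_lt hmem⟩

theorem exists_merge (h : WavesMatched k ε q X) (hk : 2 ≤ k) (hm : m = N * k) (hq : q ≤ N)
    (hε1 : ε ≤ 1) (hρ : ∀ i j : ℕ, ρ (w * i) (w * j) = 2 * |(i : ℝ) - j|)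
    (hlate : ∀ v, v ∉ X.arrived → X.time < waveTime ε (v.val / k))
    (hmerge : X.HasMergeablePair ρ 1 (sigmaL hkm w hε)) :
    ∃ X' : GDState m, ∃ q' ≤ N, GDStep ρ 1 (sigmaL hkm w hε) X X' ∧ WavesMatched k ε q' X' ∧
      X'.potential < X.potential := by
  obtain ⟨u, hu, v, hv, hne, htight⟩ := hmerge
  have hsub := h.free_union_subset hu hv
  -- At most `k` requests of the union are free, so either nothing or exactly this free part is
  -- matched.
  have hP : ∃ P : Finset (Finset (Fin m)),
      (∀ F ∈ P, F ⊆ X.free (X.A u ∪ X.A v) ∧ F.card = k) ∧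
      (∀ F ∈ P, ∀ G ∈ P, F ≠ G → Disjoint F G) ∧
      (X.free (X.A u ∪ X.A v) \ P.biUnion id).card < k := by
    have hcard := (Finset.card_le_card hsub).trans (card_wave_le (by omega) m q)
    rcases hcard.lt_or_eq with hlt | heq
    · exact ⟨∅, by simp, by simp, by simpa using hlt⟩
    · refine ⟨{X.free (X.A u ∪ X.A v)}, by simpa using heq, ?_, ?_⟩
      · simp +contextual
      · simp only [Finset.singleton_biUnion, id, Finset.sdiff_self, Finset.card_empty]
        omega
  obtain ⟨P, hP, hdisj, hrest⟩ := hP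
  have hstep : GDStep ρ 1 (sigmaL hkm w hε) X (X.merge u v P) :=
    GDStep.merge X u v P hlate hu hv hne htight hP hdisj hrest
  obtain ⟨q', hq', h'⟩ := h.step hk hε1 hρ hm hq hstep
  exact ⟨_, q', hq', hstep, h', h.potential_merge_lt hu hv hne P⟩

/-- Nothing happens strictly before the next arrival or the next matching time. -/
theorem not_hasMergeablePair_advance (h : WavesMatched k ε q X) (hk : 2 ≤ k) (hε1 : ε ≤ 1)
    (hρ : ∀ i j : ℕ, ρ (w * i) (w * j) = 2 * |(i : ℝ) - j|)
    (hno : ¬ X.HasMergeablePair ρ 1 (sigmaL hkm w hε)) {δ : ℝ} (hδ : 0 ≤ δ)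
    (harr : ∀ v, v ∉ X.arrived → v.val / k = q → X.time + δ ≤ waveTime ε q)
    (hlt : ∀ v ∈ X.arrived, v.val / k = q → X.time + δ < matchTime ε q) :
    ¬ (X.advance k 1 δ).HasMergeablePair ρ 1 (sigmaL hkm w hε) := by
  have h' := h.advance hδ harr fun v hv hvq => (hlt v hv hvq).le
  rintro ⟨u, hu, v, hv, hne, htight⟩
  have huv : u ≠ v := fun huv => hne (huv ▸ rfl)
  have huq : u.val / k < q := lt_of_le_of_ne (h.le_of_arrived u hu) fun huq =>
    h'.not_isTight hk hε1 hρ huv hu hv huq (hlt u hu huq) htight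
  have hvq : v.val / k < q := lt_of_le_of_ne (h.le_of_arrived v hv) fun hvq =>
    h'.not_isTight hk hε1 hρ huv.symm hv hu hvq (hlt v hv hvq)
      ((isTight_comm (pairOptCost_comm hρ)).1 htight)
  -- Two old requests have frozen values, so the pair was tight before the clock moved.
  rw [h'.isTight_iff hk hρ huv (h'.y_old u huq) (h'.y_old v hvq)] at htight
  exact hno ⟨u, hu, v, hv, hne,
    (h.isTight_iff hk hρ huv (h.y_old u huq) (h.y_old v hvq)).2 htight⟩

/-- The passage of time alone does not lower the potential, so it is combined with the event that
ends it. -/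
theorem exists_progress (h : WavesMatched k ε q X) (hk : 2 ≤ k) (hm : m = N * k) (hq : q < N)
    (hε1 : ε ≤ 1) (hρ : ∀ i j : ℕ, ρ (w * i) (w * j) = 2 * |(i : ℝ) - j|) :
    ∃ X' : GDState m, ∃ q' ≤ N, Relation.ReflTransGen (GDStep ρ 1 (sigmaL hkm w hε)) X X' ∧
      WavesMatched k ε q' X' ∧ X'.potential < X.potential := by
  by_cases hnow : ∃ v, v ∉ X.arrived ∧ waveTime ε (v.val / k) = X.time
  · obtain ⟨v, hv, hvt⟩ := hnow
    obtain ⟨X', q', hq', hs, h', hp⟩ :=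
      h.exists_arrive (ρ := ρ) (w := w) (hε := hε) (hkm := hkm) hk hm hq.le hv hvt
    exact ⟨X', q', hq', .single hs, h', hp⟩
  have hlate : ∀ v, v ∉ X.arrived → X.time < waveTime ε (v.val / k) := fun v hv =>
    lt_of_le_of_ne (h.time_le hk hm hε hv) fun heq => hnow ⟨v, hv, heq.symm⟩
  by_cases hmerge : X.HasMergeablePair ρ 1 (sigmaL hkm w hε)
  · obtain ⟨X', q', hq', hs, h', hp⟩ := h.exists_merge hk hm hq.le hε1 hρ hlate hmerge
    exact ⟨X', q', hq', .single hs, h', hp⟩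
  have hge : ∀ v, v ∉ X.arrived → q ≤ v.val / k := fun v hv =>
    not_lt.1 fun hlt => hv (h.arrived_of_lt v hlt)
  -- The next event is a merger at the matching time if wave `q` has fully arrived, and otherwise
  -- the arrival of this wave.
  by_cases hall : ∀ v : Fin m, v.val / k = q → v ∈ X.arrived
  · have hlt : X.time < matchTime ε q := by
      obtain ⟨x, hx⟩ := wave_nonempty (by omega) hm hq
      rw [mem_wave] at hx
      exact lt_of_le_of_ne (h.le_matchTime x (hall x hx) hx) fun heq =>
        hmerge (h.hasMergeablePair hk hm hq hρ hall heq)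
    have hafter : ∀ v, v ∉ X.arrived → matchTime ε q < waveTime ε (v.val / k) := fun v hv => by
      have : q < v.val / k := lt_of_le_of_ne (hge v hv) fun heq => hv (hall v heq.symm)
      linarith [matchTime_add_le_waveTime hε this]
    set Δ := matchTime ε q - X.time with hΔ
    have hpos : 0 < Δ := sub_pos.2 hlt
    have h₁ : WavesMatched k ε q (X.advance k 1 Δ) :=
      h.advance hpos.le (fun v hv hvq => absurd (hall v hvq) hv) fun v _ _ => by linarith
    have ht₁ : (X.advance k 1 Δ).time = matchTime ε q := by simp [GDState.advance, hΔ]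
    have hs₁ : GDStep ρ 1 (sigmaL hkm w hε) X (X.advance k 1 Δ) := by
      refine GDStep.elapse X Δ hpos (fun v hv => ?_) fun δ hδ hδΔ => ?_
      · have := hafter v hv
        change X.time + Δ ≤ waveTime ε (v.val / k)
        linarith
      · exact h.not_hasMergeablePair_advance hk hε1 hρ hmerge hδ
          (fun v hv hvq => absurd (hall v hvq) hv) fun v _ _ => by linarith
    obtain ⟨X', q', hq', hs, h', hp⟩ := h₁.exists_merge (hε := hε) (hkm := hkm) hk hm hq.le hε1 hρ
      (fun v hv => ht₁.symm ▸ hafter v hv) (h₁.hasMergeablePair hk hm hq hρ hall ht₁)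
    exact ⟨X', q', hq', .tail (.single hs₁) hs, h', hp⟩
  · push Not at hall
    obtain ⟨x, hxq, hx⟩ := hall
    have hlt : X.time < waveTime ε q := hxq ▸ hlate x hx
    have hnone : ∀ v ∈ X.arrived, v.val / k ≠ q := fun v hv hvq =>
      absurd (h.waveTime_le v hv hvq) (not_le.2 hlt)
    set Δ := waveTime ε q - X.time with hΔ
    have hpos : 0 < Δ := sub_pos.2 hlt
    have h₁ : WavesMatched k ε q (X.advance k 1 Δ) :=
      h.advance hpos.le (fun v _ _ => by linarith) fun v hv hvq => absurd hvq (hnone v hv)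
    have ht₁ : (X.advance k 1 Δ).time = waveTime ε q := by simp [GDState.advance, hΔ]
    have hs₁ : GDStep ρ 1 (sigmaL hkm w hε) X (X.advance k 1 Δ) := by
      refine GDStep.elapse X Δ hpos (fun v hv => ?_) fun δ hδ hδΔ => ?_
      · have := waveTime_mono hε (hge v hv)
        change X.time + Δ ≤ waveTime ε (v.val / k)
        linarith
      · exact h.not_hasMergeablePair_advance hk hε1 hρ hmerge hδ
          (fun v _ _ => by linarith) fun v hv hvq => absurd hvq (hnone v hv)
    obtain ⟨X', q', hq', hs, h', hp⟩ := h₁.exists_arrive (ρ := ρ) (w := w) (hε := hε) (hkm := hkm)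
      hk hm hq.le (v := x) hx (by rw [hxq, ht₁])
    exact ⟨X', q', hq', .tail (.single hs₁) hs, h', hp⟩

theorem exists_final (hk : 2 ≤ k) (hm : m = N * k) (hε1 : ε ≤ 1)
    (hρ : ∀ i j : ℕ, ρ (w * i) (w * j) = 2 * |(i : ℝ) - j|) (n : ℕ) :
    ∀ (q : ℕ) (X : GDState m), WavesMatched k ε q X → q ≤ N → X.potential ≤ n →
      ∃ X' : GDState m, Relation.ReflTransGen (GDStep ρ 1 (sigmaL hkm w hε)) X X' ∧
        WavesMatched k ε N X' := by
  induction n using Nat.strong_induction_on with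
  | _ n ih =>
    intro q X h hq hn
    rcases hq.eq_or_lt with rfl | hlt
    · exact ⟨X, .refl, h⟩
    · obtain ⟨X₁, q₁, hq₁, hs₁, h₁, hp₁⟩ :=
        h.exists_progress (hε := hε) (hkm := hkm) hk hm hlt hε1 hρ
      obtain ⟨X₂, hs₂, h₂⟩ := ih _ (hp₁.trans_le hn) q₁ X₁ h₁ hq₁ le_rfl
      exact ⟨X₂, hs₁.trans hs₂, h₂⟩

end WavesMatched

/-! ### The outputs of the algorithm. -/

section Output

variable {k m N : ℕ} {ε w : ℝ} {ρ : ℝ → ℝ → ℝ} {hkm : k ∣ m}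

theorem exists_isGDOutput (hk : 2 ≤ k) (hm : m = N * k) (hε : 0 < ε) (hε1 : ε ≤ 1)
    (hρ : ∀ i j : ℕ, ρ (w * i) (w * j) = 2 * |(i : ℝ) - j|) :
    ∃ R, IsGDOutput ρ 1 (sigmaL hkm w hε) R := by
  obtain ⟨X, hs, h⟩ := WavesMatched.exists_final (hε := hε) (hkm := hkm) hk hm hε1 hρ _ 0 _
    (wavesMatched_init k m ε) (Nat.zero_le N) le_rfl
  exact ⟨X.sched, X, hs, h.complete hm, rfl⟩

theorem wavesMatched_of_reachable (hk : 2 ≤ k) (hm : m = N * k) (hε : 0 < ε) (hε1 : ε ≤ 1)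
    (hρ : ∀ i j : ℕ, ρ (w * i) (w * j) = 2 * |(i : ℝ) - j|) {X : GDState m}
    (hX : Relation.ReflTransGen (GDStep ρ 1 (sigmaL hkm w hε)) (GDState.init m) X) :
    ∃ q ≤ N, WavesMatched k ε q X := by
  induction hX with
  | refl => exact ⟨0, Nat.zero_le N, wavesMatched_init k m ε⟩
  | tail _ hs ih =>
    obtain ⟨q, hq, h⟩ := ih
    exact h.step hk hε1 hρ hm hq hs

/-- Every output matches each wave by itself, at its matching time. -/
theorem IsGDOutput.eq_waves (hk : 2 ≤ k) (hm : m = N * k) (hε : 0 < ε) (hε1 : ε ≤ 1)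
    (hρ : ∀ i j : ℕ, ρ (w * i) (w * j) = 2 * |(i : ℝ) - j|) {R : Schedule m}
    (hR : IsGDOutput ρ 1 (sigmaL hkm w hε) R) :
    R.groups = (Finset.range N).image (wave k m) ∧
      ∀ p < N, R.mtime (wave k m p) = matchTime ε p := by
  obtain ⟨X, hX, hcomp, rfl⟩ := hR
  obtain ⟨q, hq, h⟩ := wavesMatched_of_reachable hk hm hε hε1 hρ hX
  obtain rfl := h.eq_of_complete hk hm hq hcomp
  exact ⟨h.groups, h.mtime⟩

end Output

/-! ### The diameter as a `k`-point distance. -/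

section Diameter

variable {k m : ℕ}

theorem abs_sub_le_lineDiam (p : Fin k → ℝ) (i j : Fin k) : |p i - p j| ≤ lineDiam k p :=
  le_ciSup (f := fun ij : Fin k × Fin k => |p ij.1 - p ij.2|)
    (Set.finite_range _).bddAbove (i, j)

theorem lineDiam_le (hk : 0 < k) {p : Fin k → ℝ} {c : ℝ} (h : ∀ i j, |p i - p j| ≤ c) :
    lineDiam k p ≤ c := by
  have : Nonempty (Fin k × Fin k) := ⟨(⟨0, hk⟩, ⟨0, hk⟩)⟩
  exact ciSup_le fun ij => h ij.1 ij.2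

theorem inducedDist_lineDiam (hk : 2 ≤ k) (p q : ℝ) :
    inducedDist (lineDiam k) p q = 2 * |p - q| := by
  have key : ∀ a b : ℝ, lineDiam k (fun i => if i.val = 0 then a else b) = |a - b| := by
    intro a b
    apply le_antisymm
    · refine lineDiam_le (by omega) fun i j => ?_
      split_ifs <;> simp [abs_sub_comm]
    · have := abs_sub_le_lineDiam (fun i : Fin k => if i.val = 0 then a else b)
        ⟨0, by omega⟩ ⟨1, by omega⟩
      simpa using this
  rw [inducedDist, key, key, abs_sub_comm q p]
  ring

theorem abs_sub_le_groupDist (pos : Fin m → ℝ) {F : Finset (Fin m)} (hF : F.card = k)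
    {u v : Fin m} (hu : u ∈ F) (hv : v ∈ F) :
    |pos u - pos v| ≤ groupDist (lineDiam k) pos F := by
  rw [groupDist, dif_pos hF]
  have hmem : ∀ x ∈ F, ∃ i, F.orderEmbOfFin hF i = x := fun x hx => by
    have := F.range_orderEmbOfFin hF
    exact (Set.ext_iff.1 this x).2 hx
  obtain ⟨i, rfl⟩ := hmem u hu
  obtain ⟨j, rfl⟩ := hmem v hv
  exact abs_sub_le_lineDiam (fun i => pos (F.orderEmbOfFin hF i)) i j

theorem groupDist_nonneg (pos : Fin m → ℝ) (F : Finset (Fin m)) :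
    0 ≤ groupDist (lineDiam k) pos F := by
  rw [groupDist]
  split_ifs
  · exact Real.iSup_nonneg fun _ => abs_nonneg _
  · exact le_rfl

theorem groupDist_eq_zero (hk : 0 < k) {pos : Fin m → ℝ} {F : Finset (Fin m)}
    (h : ∀ u ∈ F, ∀ v ∈ F, pos u = pos v) : groupDist (lineDiam k) pos F = 0 := by
  refine le_antisymm ?_ (groupDist_nonneg pos F)
  rw [groupDist]
  split_ifs with hF
  · refine lineDiam_le hk fun i j => ?_
    rw [h _ (F.orderEmbOfFin_mem hF i) _ (F.orderEmbOfFin_mem hF j), sub_self, abs_zero]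
  · exact le_rfl

end Diameter

/-! ### Lower bounds on costs. -/

section Cost

variable {k m N : ℕ} {ε w : ℝ} {ρ : ℝ → ℝ → ℝ} {hkm : k ∣ m}

theorem le_groupDist_wave (hk : 2 ≤ k) (hm : m = N * k) (hε : 0 < ε) {p : ℕ}
    (hp : p < N) :
    w * ((k : ℝ) - 1) ≤ groupDist (lineDiam k) (sigmaL hkm w hε).pos (wave k m p) := by
  have h1 := Nat.mul_le_mul_right k (Nat.succ_le_of_lt hp)
  rw [Nat.succ_mul] at h1
  have hmod : ∀ a, a < k → (p * k + a) / k = p ∧ (p * k + a) % k = a := fun a ha => by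
    constructor
    · rw [Nat.mul_comm, Nat.mul_add_div (by omega), Nat.div_eq_of_lt ha, add_zero]
    · rw [Nat.mul_comm, Nat.mul_add_mod, Nat.mod_eq_of_lt ha]
  have h2 := abs_sub_le_groupDist (sigmaL hkm w hε).pos (card_wave (by omega) hm hp)
    (u := ⟨p * k + (k - 1), by omega⟩) (v := ⟨p * k + 0, by omega⟩)
    (mem_wave.2 (hmod _ (by omega)).1) (mem_wave.2 (hmod _ (by omega)).1)
  simp only [sigmaL, (hmod (k - 1) (by omega)).2, (hmod 0 (by omega)).2] at h2
  rw [Nat.cast_sub (by omega)] at h2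
  push_cast at h2
  rw [mul_zero, sub_zero] at h2
  exact (le_abs_self _).trans h2

theorem le_cost_of_isGDOutput (hk : 2 ≤ k) (hm : m = N * k) (hN : 0 < N) (hε : 0 < ε)
    (hε1 : ε ≤ 1) (hρ : ∀ i j : ℕ, ρ (w * i) (w * j) = 2 * |(i : ℝ) - j|) {R : Schedule m}
    (hR : IsGDOutput ρ 1 (sigmaL hkm w hε) R) :
    w * ((k : ℝ) - 1) * N + k + ((m : ℝ) - k) * ε ≤ R.cost (lineDiam k) (sigmaL hkm w hε) := by
  obtain ⟨hg, ht⟩ := hR.eq_waves hk hm hε hε1 hρ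
  have hk0 : 0 < k := by omega
  have hinj : Set.InjOn (wave k m) (Finset.range N : Set ℕ) := by
    intro p hp p' hp' heq
    obtain ⟨x, hx⟩ := wave_nonempty hk0 hm (Finset.mem_range.1 hp)
    have hx' : x ∈ wave k m p' := heq ▸ hx
    rw [← mem_wave.1 hx, mem_wave.1 hx']
  rw [Schedule.cost, hg, Finset.sum_image hinj]
  have hterm : ∀ p ∈ Finset.range N,
      w * ((k : ℝ) - 1) + k * (matchTime ε p - waveTime ε p) ≤
        groupDist (lineDiam k) (sigmaL hkm w hε).pos (wave k m p) +
          ∑ v ∈ wave k m p, (R.mtime (wave k m p) - (sigmaL hkm w hε).atime v) := by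
    intro p hp
    rw [Finset.mem_range] at hp
    have hsum : ∑ v ∈ wave k m p, (R.mtime (wave k m p) - (sigmaL hkm w hε).atime v) =
        ∑ _v ∈ wave k m p, (matchTime ε p - waveTime ε p) := by
      refine Finset.sum_congr rfl fun v hv => ?_
      rw [ht p hp]
      simp only [sigmaL, mem_wave.1 hv]
    rw [hsum, Finset.sum_const, card_wave hk0 hm hp, nsmul_eq_mul]
    linarith [le_groupDist_wave (hkm := hkm) (w := w) hk hm hε hp]
  refine le_trans (le_of_eq ?_) (Finset.sum_le_sum hterm)
  obtain ⟨N, rfl⟩ : ∃ n, N = n + 1 := Nat.exists_eq_succ_of_ne_zero hN.ne'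
  rw [Finset.sum_add_distrib, Finset.sum_range_succ' (fun p => (k : ℝ) * _), matchTime_sub_zero]
  simp only [matchTime_sub_succ, Finset.sum_const, Finset.card_range, nsmul_eq_mul, hm]
  push_cast
  ring

/-- Two members of one group differ in their point, which costs at least `w`, or in their wave, and
then the earlier one waits at least `ε`. This makes the optimum positive and the infimum defining it
bounded below. -/
theorem le_cost_of_isFeasible (hk : 2 ≤ k) (hm0 : 0 < m) (hw : 0 < w) (hε : 0 < ε)
    {R : Schedule m} (hR : R.IsFeasible (sigmaL hkm w hε)) :
    min w ε ≤ R.cost (lineDiam k) (sigmaL hkm w hε) := by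
  obtain ⟨hcard, -, hcov, htime⟩ := hR
  obtain ⟨F, hF, -⟩ := hcov ⟨0, hm0⟩
  have hwait : ∀ G ∈ R.groups, ∀ v ∈ G, 0 ≤ R.mtime G - (sigmaL hkm w hε).atime v :=
    fun G hG v hv => sub_nonneg.2 (htime G hG v hv)
  have hF1 : groupDist (lineDiam k) (sigmaL hkm w hε).pos F +
      ∑ v ∈ F, (R.mtime F - (sigmaL hkm w hε).atime v) ≤
        R.cost (lineDiam k) (sigmaL hkm w hε) :=
    Finset.single_le_sum (f := fun F => groupDist (lineDiam k) (sigmaL hkm w hε).pos F +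
      ∑ v ∈ F, (R.mtime F - (sigmaL hkm w hε).atime v))
      (fun G hG => add_nonneg (groupDist_nonneg _ _) (Finset.sum_nonneg (hwait G hG))) hF
  refine le_trans ?_ hF1
  have hFw := Finset.sum_nonneg (hwait F hF)
  obtain ⟨u, hu, v, hv, huv⟩ := Finset.one_lt_card.1 (show 1 < F.card by rw [hcard F hF]; omega)
  by_cases hmod : u.val % k = v.val % k
  · refine (min_le_right _ _).trans ?_
    have hdiv : u.val / k ≠ v.val / k := by
      intro hdiv
      apply huv
      apply Fin.ext
      rw [← Nat.div_add_mod u.val k, ← Nat.div_add_mod v.val k, hdiv, hmod]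
    have key : ∀ x ∈ F, ∀ y ∈ F, x.val / k < y.val / k →
        ε ≤ ∑ v ∈ F, (R.mtime F - (sigmaL hkm w hε).atime v) := by
      intro x hx y hy hlt
      refine le_trans ?_ (Finset.single_le_sum (hwait F hF) hx)
      have h1 := htime F hF y hy
      simp only [sigmaL] at h1 ⊢
      linarith [matchTime_add_le_waveTime hε hlt, waveTime_lt_matchTime hε (x.val / k)]
    have hg := groupDist_nonneg (k := k) (sigmaL hkm w hε).pos F
    rcases hdiv.lt_or_gt with hlt | hlt
    · linarith [key u hu v hv hlt]
    · linarith [key v hv u hu hlt]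
  · refine (min_le_left _ _).trans ?_
    have h1 := abs_sub_le_groupDist (sigmaL hkm w hε).pos (hcard F hF) hu hv
    have h2 : (1 : ℝ) ≤ |((u.val % k : ℕ) : ℝ) - ((v.val % k : ℕ) : ℝ)| := by
      have : (1 : ℤ) ≤ |((u.val % k : ℕ) : ℤ) - ((v.val % k : ℕ) : ℤ)| := by
        apply Int.one_le_abs
        omega
      exact_mod_cast this
    have h3 : |(sigmaL hkm w hε).pos u - (sigmaL hkm w hε).pos v| =
        w * |((u.val % k : ℕ) : ℝ) - ((v.val % k : ℕ) : ℝ)| := by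
      simp only [sigmaL, ← mul_sub, abs_mul, abs_of_pos hw]
    have h4 := mul_le_mul_of_nonneg_left h2 hw.le
    linarith

end Cost

/-! ### The offline optimum. -/

section Optimum

variable {k m s : ℕ} {ε w : ℝ} {hkm : k ∣ m}

/-- The requests at point number `c.2` in the `k` consecutive waves starting with wave number
`c.1 * k`. -/
def block (k m : ℕ) (c : ℕ × ℕ) : Finset (Fin m) :=
  Finset.univ.filter fun v => v.val / k / k = c.1 ∧ v.val % k = c.2

theorem mem_block {c : ℕ × ℕ} {v : Fin m} :
    v ∈ block k m c ↔ v.val / k / k = c.1 ∧ v.val % k = c.2 := by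
  simp [block]

/-- A block contains one request from each of its `k` waves, so the wave number modulo `k`
enumerates it. -/
theorem sum_block {M : Type*} [AddCommMonoid M] (hk : 0 < k) (hm : m = s * k ^ 2) {c : ℕ × ℕ}
    (hc : c ∈ Finset.range s ×ˢ Finset.range k) (f : ℕ → M) :
    ∑ v ∈ block k m c, f (v.val / k % k) = ∑ i ∈ Finset.range k, f i := by
  rw [Finset.mem_product, Finset.mem_range, Finset.mem_range] at hc
  refine Finset.sum_nbij (fun v => v.val / k % k) ?_ ?_ ?_ fun _ _ => rfl
  · intro v _
    exact Finset.mem_range.2 (Nat.mod_lt _ hk)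
  · intro u hu v hv huv
    obtain ⟨hu1, hu2⟩ := mem_block.1 hu
    obtain ⟨hv1, hv2⟩ := mem_block.1 hv
    simp only at huv
    apply Fin.ext
    rw [← Nat.div_add_mod u.val k, ← Nat.div_add_mod v.val k, hu2, hv2,
      ← Nat.div_add_mod (u.val / k) k, ← Nat.div_add_mod (v.val / k) k, hu1, hv1, huv]
  · intro i hi
    have hi' : i < k := by simpa using hi
    have h1 : (k * (k * c.1 + i) + c.2) / k = k * c.1 + i := by
      rw [Nat.mul_add_div hk, Nat.div_eq_of_lt hc.2, add_zero]
    have hlt : k * (k * c.1 + i) + c.2 < m := by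
      have h2 : k * c.1 + k ≤ k * s := by
        have := Nat.mul_le_mul_left k (Nat.succ_le_of_lt hc.1)
        rwa [Nat.mul_succ] at this
      have h3 : k * (k * c.1 + i + 1) ≤ k * (k * s) := Nat.mul_le_mul_left k (by omega)
      have h4 : m = k * (k * s) := by rw [hm]; ring
      rw [Nat.mul_succ] at h3
      omega
    refine ⟨⟨k * (k * c.1 + i) + c.2, hlt⟩, ?_, ?_⟩
    · rw [Finset.mem_coe, mem_block]
      simp only
      rw [h1, Nat.mul_add_div hk, Nat.div_eq_of_lt hi', add_zero, Nat.mul_add_mod,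
        Nat.mod_eq_of_lt hc.2]
      exact ⟨rfl, rfl⟩
    · simp only
      rw [h1, Nat.mul_add_mod, Nat.mod_eq_of_lt hi']

theorem card_block (hk : 0 < k) (hm : m = s * k ^ 2) {c : ℕ × ℕ}
    (hc : c ∈ Finset.range s ×ˢ Finset.range k) : (block k m c).card = k := by
  simpa using sum_block hk hm hc fun _ => (1 : ℕ)

/-- Match, at every point, the requests of `k` consecutive waves when the last of them arrives. -/
noncomputable def blockSchedule (k m s : ℕ) (ε : ℝ) : Schedule m where
  groups := (Finset.range s ×ˢ Finset.range k).image (block k m)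
  mtime F := waveTime ε (F.sup fun v => v.val / k)

theorem blockSchedule_isFeasible (hk : 0 < k) (hm : m = s * k ^ 2) (hε : 0 < ε) :
    (blockSchedule k m s ε).IsFeasible (sigmaL hkm w hε) := by
  refine ⟨?_, ?_, ?_, ?_⟩
  · simp only [blockSchedule, Finset.forall_mem_image]
    exact fun c hc => card_block hk hm hc
  · simp only [blockSchedule, Finset.forall_mem_image]
    intro c _ c' _ hne
    rw [Finset.disjoint_left]
    intro v hv hv'
    rw [mem_block] at hv hv'
    exact hne (congrArg _ (Prod.ext (hv.1.symm.trans hv'.1) (hv.2.symm.trans hv'.2)))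
  · intro v
    refine ⟨block k m (v.val / k / k, v.val % k), Finset.mem_image_of_mem _ ?_,
      mem_block.2 ⟨rfl, rfl⟩⟩
    rw [Finset.mem_product, Finset.mem_range, Finset.mem_range]
    refine ⟨?_, Nat.mod_lt _ hk⟩
    rw [Nat.div_div_eq_div_mul]
    apply Nat.div_lt_of_lt_mul
    calc v.val < m := v.isLt
      _ = k * k * s := by rw [hm]; ring
  · intro F _ v hv
    exact waveTime_mono hε (Finset.le_sup (f := fun v : Fin m => v.val / k) hv)

theorem sum_range_two_mul_sub (c : ℝ) (n : ℕ) :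
    ∑ i ∈ Finset.range n, 2 * (c - i) = 2 * c * n - n * ((n : ℝ) - 1) := by
  induction n with
  | zero => simp
  | succ n ih =>
    rw [Finset.sum_range_succ, ih]
    push_cast
    ring

/-- Consecutive waves are `2 ε` apart except after the first one, which arrives at `0` instead of `1
- ε`; the summand `1` absorbs this. -/
theorem waveTime_sub_le (hk : 2 ≤ k) (hε : 0 < ε) {j i : ℕ} :
    waveTime ε (k * j + (k - 1)) - waveTime ε (k * j + i) ≤
      2 * (((k : ℝ) - 1) - i) * ε + if i = 0 then (if j = 0 then 1 else 0) else 0 := by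
  have h1 : waveTime ε (k * j + (k - 1)) = 1 + (2 * ((k : ℝ) * j + (k - 1)) - 1) * ε := by
    rw [waveTime, if_neg (by omega)]
    push_cast [Nat.cast_sub (show 1 ≤ k by omega)]
    rfl
  rw [h1, waveTime]
  by_cases hj : j = 0
  · by_cases hi : i = 0
    · simp only [hi, hj, mul_zero, add_zero, if_true, Nat.cast_zero]
      nlinarith
    · rw [if_neg (by simp [hi]), if_neg hi]
      push_cast
      nlinarith
  · have : k * j ≠ 0 := Nat.mul_ne_zero (by omega) hj
    rw [if_neg (by omega), if_neg hj, ite_self]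
    push_cast
    nlinarith

theorem blockSchedule_cost_le (hk : 2 ≤ k) (hm : m = s * k ^ 2) (hs : 1 ≤ s) (hε : 0 < ε) :
    (blockSchedule k m s ε).cost (lineDiam k) (sigmaL hkm w hε) ≤
      k + (m : ℝ) * ((k : ℝ) - 1) * ε := by
  have hk0 : 0 < k := by omega
  have hinj : Set.InjOn (block k m) (Finset.range s ×ˢ Finset.range k : Finset (ℕ × ℕ)) := by
    intro c hc c' _ heq
    obtain ⟨x, hx⟩ : (block k m c).Nonempty := by
      rw [← Finset.card_pos, card_block hk0 hm hc]
      exact hk0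
    have hx' : x ∈ block k m c' := heq ▸ hx
    rw [mem_block] at hx hx'
    exact Prod.ext (hx.1.symm.trans hx'.1) (hx.2.symm.trans hx'.2)
  have hterm : ∀ c ∈ Finset.range s ×ˢ Finset.range k,
      groupDist (lineDiam k) (sigmaL hkm w hε).pos (block k m c) +
        ∑ v ∈ block k m c, ((blockSchedule k m s ε).mtime (block k m c) -
          (sigmaL hkm w hε).atime v) ≤
      (k : ℝ) * (k - 1) * ε + if c.1 = 0 then 1 else 0 := by
    intro c hc
    have hg : groupDist (lineDiam k) (sigmaL hkm w hε).pos (block k m c) = 0 := by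
      refine groupDist_eq_zero hk0 fun u hu v hv => ?_
      simp only [sigmaL, (mem_block.1 hu).2, (mem_block.1 hv).2]
    have hsup : ((block k m c).sup fun v => v.val / k) ≤ k * c.1 + (k - 1) := by
      refine Finset.sup_le fun v hv => ?_
      have h1 := Nat.div_add_mod (v.val / k) k
      have h2 := Nat.mod_lt (v.val / k) hk0
      rw [(mem_block.1 hv).1] at h1
      omega
    rw [hg, zero_add]
    calc _ ≤ ∑ v ∈ block k m c, (2 * (((k : ℝ) - 1) - ((v.val / k % k : ℕ) : ℝ)) * ε +
          if v.val / k % k = 0 then (if c.1 = 0 then 1 else 0) else 0) := by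
          refine Finset.sum_le_sum fun v hv => ?_
          refine le_trans ?_ (waveTime_sub_le hk hε (j := c.1))
          have h1 := Nat.div_add_mod (v.val / k) k
          rw [(mem_block.1 hv).1] at h1
          rw [h1]
          exact sub_le_sub_right (waveTime_mono hε hsup) _
      _ = ∑ i ∈ Finset.range k, (2 * (((k : ℝ) - 1) - (i : ℝ)) * ε +
          if i = 0 then (if c.1 = 0 then 1 else 0) else 0) :=
          sum_block hk0 hm hc fun i => 2 * (((k : ℝ) - 1) - (i : ℝ)) * ε +
            if i = 0 then (if c.1 = 0 then 1 else 0) else 0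
      _ = _ := by
          rw [Finset.sum_add_distrib, ← Finset.sum_mul, sum_range_two_mul_sub,
            Finset.sum_ite_eq' (Finset.range k) 0 fun _ => (if c.1 = 0 then (1 : ℝ) else 0),
            if_pos (Finset.mem_range.2 hk0)]
          ring
  rw [Schedule.cost]
  simp only [blockSchedule] at hterm ⊢
  rw [Finset.sum_image hinj]
  refine (Finset.sum_le_sum hterm).trans (le_of_eq ?_)
  have hfirst : ∑ c ∈ Finset.range s ×ˢ Finset.range k, (if c.1 = 0 then (1 : ℝ) else 0) = k := by
    rw [Finset.sum_product_right]
    simp [show 0 < s by omega]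
  rw [Finset.sum_add_distrib, hfirst, Finset.sum_const, Finset.card_product, Finset.card_range,
    Finset.card_range, nsmul_eq_mul, hm]
  push_cast
  ring

theorem OPT_pos (hk : 2 ≤ k) (hm : m = s * k ^ 2) (hs : 1 ≤ s) (hw : 0 < w) (hε : 0 < ε) :
    0 < OPT (lineDiam k) (sigmaL hkm w hε) := by
  have hm0 : 0 < m := by rw [hm]; positivity
  refine (lt_min hw hε).trans_le (le_csInf ?_ ?_)
  · exact ⟨_, _, blockSchedule_isFeasible (by omega) hm hε, rfl⟩
  · rintro _ ⟨R, hR, rfl⟩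
    exact le_cost_of_isFeasible hk hm0 hw hε hR

theorem OPT_le (hk : 2 ≤ k) (hm : m = s * k ^ 2) (hs : 1 ≤ s) (hw : 0 < w) (hε : 0 < ε) :
    OPT (lineDiam k) (sigmaL hkm w hε) ≤ k + (m : ℝ) * ((k : ℝ) - 1) * ε := by
  have hm0 : 0 < m := by rw [hm]; positivity
  have hbdd : BddBelow {c : ℝ | ∃ R : Schedule m, R.IsFeasible (sigmaL hkm w hε) ∧
      R.cost (lineDiam k) (sigmaL hkm w hε) = c} := by
    refine ⟨min w ε, ?_⟩
    rintro _ ⟨R, hR, rfl⟩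
    exact le_cost_of_isFeasible hk hm0 hw hε hR
  exact (csInf_le hbdd ⟨_, blockSchedule_isFeasible (by omega) hm hε, rfl⟩).trans
    (blockSchedule_cost_le hk hm hs hε)

end Optimum

/-! ### Comparison of the two costs. -/

/-- The lower bound for any distance between points for which consecutive points of the line are at
distance `2`. -/
theorem gd_lower_bound {k s m : ℕ} (hk : 2 ≤ k) (hs : 1 ≤ s) (hm : m = s * k ^ 2) {w : ℝ}
    (hw : 0 < w) {ρ : ℝ → ℝ → ℝ} (hρ : ∀ i j : ℕ, ρ (w * i) (w * j) = 2 * |(i : ℝ) - j|)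
    {L : ℝ} (hL0 : 0 ≤ L) (hL : L ≤ w * ((k : ℝ) - 1) * (s * k : ℕ)) :
    (∀ (ε : ℝ) (hε : 0 < ε),
        0 < OPT (lineDiam k) (sigmaL (dvd_of_eq_mul_sq hm) w hε) ∧
        OPT (lineDiam k) (sigmaL (dvd_of_eq_mul_sq hm) w hε) ≤
          (k : ℝ) * (1 + ε + (k : ℝ) ^ 2 * ε + (m : ℝ) * ε) ∧
        (ε ≤ 1 → (∃ R, IsGDOutput ρ 1 (sigmaL (dvd_of_eq_mul_sq hm) w hε) R) ∧
          ∀ R, IsGDOutput ρ 1 (sigmaL (dvd_of_eq_mul_sq hm) w hε) R →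
          L + k + ((m : ℝ) - k) * ε ≤
            R.cost (lineDiam k) (sigmaL (dvd_of_eq_mul_sq hm) w hε)) ∧
        (ε ≤ 1 / max ((k : ℝ) ^ 2) (m : ℝ) →
          ∀ R, IsGDOutput ρ 1 (sigmaL (dvd_of_eq_mul_sq hm) w hε) R →
            (L + k) / (4 * k) ≤
              R.cost (lineDiam k) (sigmaL (dvd_of_eq_mul_sq hm) w hε) /
                OPT (lineDiam k) (sigmaL (dvd_of_eq_mul_sq hm) w hε))) ∧
      ENNReal.ofReal ((L + k) / (4 * k)) ≤ gdCompetitiveRatio (lineDiam k) ρ 1 m := by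
  have hmN : m = (s * k) * k := by rw [hm]; ring
  have hN : 0 < s * k := Nat.mul_pos (by omega) (by omega)
  have hk2 : (2 : ℝ) ≤ k := by exact_mod_cast hk
  have hkm : (k : ℝ) ≤ m := by
    have : k ≤ m := by rw [hmN]; exact Nat.le_mul_of_pos_left k hN
    exact_mod_cast this
  have hmax : 1 ≤ max ((k : ℝ) ^ 2) (m : ℝ) := le_max_of_le_left (by nlinarith)
  have hcost : ∀ (ε : ℝ) (hε : 0 < ε), ε ≤ 1 →
      ∀ R, IsGDOutput ρ 1 (sigmaL (dvd_of_eq_mul_sq hm) w hε) R →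
        L + k + ((m : ℝ) - k) * ε ≤
          R.cost (lineDiam k) (sigmaL (dvd_of_eq_mul_sq hm) w hε) := by
    intro ε hε hε1 R hR
    have := le_cost_of_isGDOutput hk hmN hN hε hε1 hρ hR
    linarith
  have hopt : ∀ (ε : ℝ) (hε : 0 < ε),
      OPT (lineDiam k) (sigmaL (dvd_of_eq_mul_sq hm) w hε) ≤
        (k : ℝ) * (1 + ε + (k : ℝ) ^ 2 * ε + (m : ℝ) * ε) := by
    intro ε hε
    refine (OPT_le hk hm hs hw hε).trans ?_
    have h1 : 0 ≤ (k : ℝ) * ε := by positivity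
    have h2 : 0 ≤ (k : ℝ) * ((k : ℝ) ^ 2 * ε) := by positivity
    have h3 : 0 ≤ (m : ℝ) * ε := by positivity
    linarith
  have hle1 : ∀ ε : ℝ, ε ≤ 1 / max ((k : ℝ) ^ 2) (m : ℝ) → ε ≤ 1 := fun ε h =>
    h.trans ((div_le_one (by linarith)).2 hmax)
  have hratio : ∀ (ε : ℝ) (hε : 0 < ε), ε ≤ 1 / max ((k : ℝ) ^ 2) (m : ℝ) →
      ∀ R, IsGDOutput ρ 1 (sigmaL (dvd_of_eq_mul_sq hm) w hε) R →
        (L + k) / (4 * k) ≤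
          R.cost (lineDiam k) (sigmaL (dvd_of_eq_mul_sq hm) w hε) /
            OPT (lineDiam k) (sigmaL (dvd_of_eq_mul_sq hm) w hε) := by
    intro ε hε hεm R hR
    have hε1 := hle1 ε hεm
    rw [le_div_iff₀ (by linarith)] at hεm
    have h1 : (k : ℝ) ^ 2 * ε ≤ 1 := by nlinarith [le_max_left ((k : ℝ) ^ 2) (m : ℝ)]
    have h2 : (m : ℝ) * ε ≤ 1 := by nlinarith [le_max_right ((k : ℝ) ^ 2) (m : ℝ)]
    -- Each of the four summands in the bound on the optimum is at most `1`.
    have h3 : OPT (lineDiam k) (sigmaL (dvd_of_eq_mul_sq hm) w hε) ≤ 4 * k := by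
      refine (hopt ε hε).trans ?_
      nlinarith
    have h4 := hcost ε hε hε1 R hR
    have h5 : 0 ≤ ((m : ℝ) - k) * ε := mul_nonneg (by linarith) hε.le
    refine div_le_div₀ (by linarith) (by linarith) (OPT_pos hk hm hs hw hε) h3
  refine ⟨fun ε hε => ⟨OPT_pos hk hm hs hw hε, hopt ε hε,
    fun hε1 => ⟨exists_isGDOutput hk hmN hε hε1 hρ, hcost ε hε hε1⟩, hratio ε hε⟩, ?_⟩
  have hε : 0 < 1 / max ((k : ℝ) ^ 2) (m : ℝ) := by positivity
  obtain ⟨R, hR⟩ := exists_isGDOutput (hkm := dvd_of_eq_mul_sq hm) hk hmN hε (hle1 _ le_rfl) hρ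
  refine (ENNReal.ofReal_le_ofReal (hratio _ hε le_rfl R hR)).trans ?_
  rw [ENNReal.ofReal_div_of_pos (OPT_pos hk hm hs hw hε)]
  exact le_iSup_of_le (sigmaL (dvd_of_eq_mul_sq hm) w hε) (le_iSup_of_le R (le_iSup_of_le hR le_rfl))

theorem theorem4 (k s m : ℕ) (hk : 2 ≤ k) (hs : 1 ≤ s) (hm : m = s * k ^ 2) :
    -- pairs are priced with the distance |p - q|; consecutive points are at distance 2
    ((∀ (ε : ℝ) (hε : 0 < ε),
        0 < OPT (lineDiam k) (sigmaL (dvd_of_eq_mul_sq hm) 2 hε) ∧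
        OPT (lineDiam k) (sigmaL (dvd_of_eq_mul_sq hm) 2 hε) ≤
          (k : ℝ) * (1 + ε + (k : ℝ) ^ 2 * ε + (m : ℝ) * ε) ∧
        (ε ≤ 1 → (∃ R, IsGDOutput lineDist 1 (sigmaL (dvd_of_eq_mul_sq hm) 2 hε) R) ∧
          ∀ R, IsGDOutput lineDist 1 (sigmaL (dvd_of_eq_mul_sq hm) 2 hε) R →
          (m : ℝ) + k + ((m : ℝ) - k) * ε ≤
            R.cost (lineDiam k) (sigmaL (dvd_of_eq_mul_sq hm) 2 hε)) ∧
        (ε ≤ 1 / max ((k : ℝ) ^ 2) (m : ℝ) →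
          ∀ R, IsGDOutput lineDist 1 (sigmaL (dvd_of_eq_mul_sq hm) 2 hε) R →
            ((m : ℝ) + k) / (4 * k) ≤
              R.cost (lineDiam k) (sigmaL (dvd_of_eq_mul_sq hm) 2 hε) /
                OPT (lineDiam k) (sigmaL (dvd_of_eq_mul_sq hm) 2 hε))) ∧
      ENNReal.ofReal (((m : ℝ) + k) / (4 * k)) ≤
        gdCompetitiveRatio (lineDiam k) lineDist 1 m) ∧
    -- pairs are priced with the distance induced by the k-point metric, that is 2 |p - q|;
    -- consecutive points are at induced distance 2
    ((∀ (ε : ℝ) (hε : 0 < ε),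
        0 < OPT (lineDiam k) (sigmaL (dvd_of_eq_mul_sq hm) 1 hε) ∧
        OPT (lineDiam k) (sigmaL (dvd_of_eq_mul_sq hm) 1 hε) ≤
          (k : ℝ) * (1 + ε + (k : ℝ) ^ 2 * ε + (m : ℝ) * ε) ∧
        (ε ≤ 1 → (∃ R, IsGDOutput (inducedDist (lineDiam k)) 1 (sigmaL (dvd_of_eq_mul_sq hm) 1 hε) R) ∧
          ∀ R, IsGDOutput (inducedDist (lineDiam k)) 1 (sigmaL (dvd_of_eq_mul_sq hm) 1 hε) R →
          (m : ℝ) / 2 + k + ((m : ℝ) - k) * ε ≤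
            R.cost (lineDiam k) (sigmaL (dvd_of_eq_mul_sq hm) 1 hε)) ∧
        (ε ≤ 1 / max ((k : ℝ) ^ 2) (m : ℝ) →
          ∀ R, IsGDOutput (inducedDist (lineDiam k)) 1 (sigmaL (dvd_of_eq_mul_sq hm) 1 hε) R →
            ((m : ℝ) / 2 + k) / (4 * k) ≤
              R.cost (lineDiam k) (sigmaL (dvd_of_eq_mul_sq hm) 1 hε) /
                OPT (lineDiam k) (sigmaL (dvd_of_eq_mul_sq hm) 1 hε))) ∧
      ENNReal.ofReal (((m : ℝ) / 2 + k) / (4 * k)) ≤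
        gdCompetitiveRatio (lineDiam k) (inducedDist (lineDiam k)) 1 m) := by
  have hkR : (2 : ℝ) ≤ k := by exact_mod_cast hk
  have hmR : (m : ℝ) = (s : ℝ) * k * k := by
    rw [hm]
    push_cast
    ring
  have hsk : (0 : ℝ) ≤ (s : ℝ) * k := by positivity
  -- The distance cost of the waves is at least `w (k - 1) m / k`. As `k ≥ 2`, this is at least `m`
  -- for `w = 2` and at least `m / 2` for `w = 1`.
  refine ⟨gd_lower_bound hk hs hm two_pos ?_ (by positivity) ?_,
    gd_lower_bound hk hs hm one_pos ?_ (by positivity) ?_⟩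
  · intro i j
    rw [lineDist, ← mul_sub, abs_mul, abs_two]
  · push_cast
    rw [hmR]
    nlinarith
  · intro i j
    rw [inducedDist_lineDiam hk, one_mul, one_mul]
  · push_cast
    rw [hmR]
    nlinarith
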